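/- Let $q>0$, $q\neq 1$, let $0\le R_1<R_2\le+\infty$ and let $M,N\in\mathbb{R}$ be such that $M+N\ln r>0$ for all $r\in(R_1,R_2)$. On the annular domain $\Omega=\{x\in\mathbb{R}^2: R_1<|x|<R_2\}$ consider, for $\varepsilon=\pm1$, the equation $$\Delta u=\varepsilon\,|x|^{-2}\,(M+N\ln|x|)^{1-q}\,u|u|^{q-1}.\qquad (*)$$ A solution is a function $u\in C^2(\Omega)$ satisfying $(*)$ in $\Omega$. It is called pseudo-radial if in polar coordinates $u(r,\theta)=h(r)w(\theta)$ for some functions $h$ on $(R_1,R_2)$ and some $2\pi$-periodic function $w$, and radial if it depends only on $|x|$. 1. If $\varepsilon=+1$, then every pseudo-radial solution of $(*)$ is radial. 2. Let $\varepsilon=-1$. For every integer $k\ge1$ the ordinary differential equation $$w''=-w|w|^{q-1}\quad\text{on }\mathbb{R}$$ has a sign-changing $C^2$ solution $w_k$ of least period $2\pi/k$ with $w_k(0)=0$. It is unique up to sign among the sign-changing solutions of least period $2\pi/k$ that vanish at $0$; every sign-changing solution of least period $2\pi/k$ is of the form $\pm w_k(\cdot-\varphi)$ with $\varphi\in\mathbb{R}$.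 The non-radial pseudo-radial solutions of $(*)$ are exactly the functions $$u(r,\theta)=\pm(M+N\ln r)\,w_k(\theta-\varphi),\qquad k\ge1,\ \varphi\in\mathbb{R},$$ that is, up to rotation, the functions $\pm(M+N\ln|x|)\,w_k(\theta)$, $k\ge 1$; the integer $k$ is determined by $u$. -/

import Mathlib

noncomputable section

namespace PseudoRadial

/-- The Euclidean plane. -/
abbrev Plane : Type := EuclideanSpace ℝ (Fin 2)

/-- The point with polar coordinates `(r, θ)`. -/
def polar (r θ : ℝ) : Plane := !₂[r * Real.cos θ, r * Real.sin θ]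

/-- The annular domain `{R₁ < |x| < R₂}`, where `R₂ = +∞` is allowed. -/
def annulus (R₁ : ℝ) (R₂ : EReal) : Set Plane :=
  {x | R₁ < ‖x‖ ∧ ((‖x‖ : ℝ) : EReal) < R₂}

/-- `u` is a classical (`C²`) solution in `{R₁ < |x| < R₂}` of
`Δ u = ε |x|⁻² (M + N ln |x|) ^ (1 - q) u |u| ^ (q - 1)`. -/
def IsSolution (R₁ : ℝ) (R₂ : EReal) (M N ε q : ℝ) (u : Plane → ℝ) : Prop :=
  ContDiffOn ℝ 2 u (annulus R₁ R₂) ∧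
    ∀ x ∈ annulus R₁ R₂,
      Laplacian.laplacian u x =
        ε * (‖x‖ ^ 2)⁻¹ * (M + N * Real.log ‖x‖) ^ (1 - q) * (u x * |u x| ^ (q - 1))

/-- In polar coordinates `u(r, θ) = h(r) w(θ)`, with `w` a function on the circle. -/
def IsPseudoRadial (R₁ : ℝ) (R₂ : EReal) (u : Plane → ℝ) : Prop :=
  ∃ h w : ℝ → ℝ, Function.Periodic w (2 * Real.pi) ∧
    ∀ r θ : ℝ, R₁ < r → (r : EReal) < R₂ → u (polar r θ) = h r * w θ

/-- `u` depends only on `|x|` in the annulus. -/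
def IsRadial (R₁ : ℝ) (R₂ : EReal) (u : Plane → ℝ) : Prop :=
  ∀ x ∈ annulus R₁ R₂, ∀ y ∈ annulus R₁ R₂, ‖x‖ = ‖y‖ → u x = u y

/-- `w` is a `C²` solution on `ℝ` of `w'' + μ w = ε w |w| ^ (q - 1)`. -/
def IsODESolution (μ ε q : ℝ) (w : ℝ → ℝ) : Prop :=
  ContDiff ℝ 2 w ∧
    ∀ θ, deriv (deriv w) θ + μ * w θ = ε * (w θ * |w θ| ^ (q - 1))

/-- `w` takes both positive and negative values. -/
def IsSignChanging (w : ℝ → ℝ) : Prop :=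
  (∃ θ, 0 < w θ) ∧ ∃ θ, w θ < 0

/-- `T` is the least positive period of `w`. -/
def HasLeastPeriod (w : ℝ → ℝ) (T : ℝ) : Prop :=
  IsLeast {S : ℝ | 0 < S ∧ Function.Periodic w S} T

/-- `w` is a sign-changing solution, of least period `2π / k`, of the equation
`w'' + μ w = ε w |w| ^ (q - 1)` with `μ = 0` and `ε = -1`. -/
def IsAngularMode (q : ℝ) (k : ℕ) (w : ℝ → ℝ) : Prop :=
  IsODESolution 0 (-1) q w ∧ IsSignChanging w ∧ HasLeastPeriod w (2 * Real.pi / k)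

/-- On the annulus, `u(r, θ) = ± (M + N ln r) w(θ - φ)` for some sign and some rotation
angle `φ`. -/
def IsRotatedProfile (R₁ : ℝ) (R₂ : EReal) (M N : ℝ) (w : ℝ → ℝ) (u : Plane → ℝ) : Prop :=
  ∃ s φ : ℝ, (s = 1 ∨ s = -1) ∧
    ∀ r θ : ℝ, R₁ < r → (r : EReal) < R₂ →
      u (polar r θ) = s * ((M + N * Real.log r) * w (θ - φ))

end PseudoRadial

end

/-!
In the coordinates `t = ln |x|` and `θ`, the operator `|x|² Δ` becomes `∂ₜ² + ∂_θ²`, so with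
`p(t) = M + N t` a product `u = f(t) w(θ)` is a solution when
`f'' w + f w'' = ε p ^ (1 - q) (f w) |f w| ^ (q - 1)`. If `w` is not constant, then `|w|` takes two
different nonzero values; eliminating `f''` between these two angles determines `|f / p| ^ (q - 1)`
by the angles alone wherever `f ≠ 0`. Since `q ≠ 1`, the continuous function `f / p` takes at most
three values, hence is constant, and as `p'' = 0` the equation reduces to `w'' = ε w |w| ^ (q - 1)`.

For `ε = 1`, the function `w w'` is periodic with derivative `w' ^ 2 + |w| ^ (q + 1) ≥ 0`, which
forces `w' = 0`. For `ε = -1`, the energy `w' ^ 2 + 2 / (q + 1) |w| ^ (q + 1)` is conserved, so a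
solution is determined by a zero and the slope there, although the equation is not Lipschitz at `0`
when `q < 1`. All nonzero periodic solutions are thus translates of `± ρ S(c t)` for one generalized
sine `S`, where the frequency `c` is proportional to `ρ ^ ((q - 1) / 2)`: for `q ≠ 1` exactly one
amplitude `ρ` gives the least period `2 π / k`.
-/

noncomputable section

open Set Filter Topology MeasureTheory

namespace PseudoRadial

/-- The odd power function `x ↦ x |x| ^ (p - 1)`, the nonlinearity of all the equations here. -/
def signedPow (p x : ℝ) : ℝ := x * |x| ^ (p - 1)

@[simp]
theorem signedPow_zero (p : ℝ) : signedPow p 0 = 0 := by simp [signedPow]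

theorem signedPow_neg (p x : ℝ) : signedPow p (-x) = -signedPow p x := by simp [signedPow]

@[simp]
theorem signedPow_one (p : ℝ) : signedPow p 1 = 1 := by simp [signedPow]

theorem signedPow_of_pos {p x : ℝ} (hx : 0 < x) : signedPow p x = x ^ p := by
  rw [signedPow, abs_of_pos hx, Real.rpow_sub_one hx.ne', mul_div_cancel₀ _ hx.ne']

theorem signedPow_mul (p x y : ℝ) : signedPow p (x * y) = signedPow p x * signedPow p y := by
  simp only [signedPow, abs_mul, Real.mul_rpow (abs_nonneg x) (abs_nonneg y)]
  ring

theorem abs_signedPow {p : ℝ} (hp : p ≠ 0) (x : ℝ) : |signedPow p x| = |x| ^ p := by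
  rcases eq_or_ne x 0 with rfl | hx
  · simp [hp]
  · rw [← signedPow_of_pos (abs_pos.2 hx), signedPow, signedPow, abs_mul, abs_abs,
      abs_of_nonneg (Real.rpow_nonneg (abs_nonneg x) _)]

theorem mul_signedPow_nonneg (p x : ℝ) : 0 ≤ x * signedPow p x := by
  rw [signedPow, ← mul_assoc]
  exact mul_nonneg (mul_self_nonneg x) (Real.rpow_nonneg (abs_nonneg x) _)

theorem signedPow_nonpos {x : ℝ} (p : ℝ) (hx : x ≤ 0) : signedPow p x ≤ 0 :=
  mul_nonpos_of_nonpos_of_nonneg hx (Real.rpow_nonneg (abs_nonneg x) _)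

@[simp]
theorem signedPow_eq_zero {p x : ℝ} : signedPow p x = 0 ↔ x = 0 := by
  refine ⟨fun h => ?_, fun h => by rw [h, signedPow_zero]⟩
  by_contra hx
  exact mul_ne_zero hx (Real.rpow_pos_of_pos (abs_pos.2 hx) _).ne' h

theorem signedPow_signedPow (p q x : ℝ) : signedPow q (signedPow p x) = signedPow (p * q) x := by
  have pos_case {y : ℝ} (hy : 0 < y) : signedPow q (signedPow p y) = signedPow (p * q) y := by
    rw [signedPow_of_pos hy, signedPow_of_pos hy, signedPow_of_pos (Real.rpow_pos_of_pos hy p),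
      Real.rpow_mul hy.le]
  rcases lt_trichotomy x 0 with hx | rfl | hx
  · simpa only [signedPow_neg, neg_inj] using pos_case (neg_pos.2 hx)
  · simp only [signedPow_zero]
  · exact pos_case hx

theorem contDiffAt_signedPow (p : ℝ) {x : ℝ} (hx : x ≠ 0) {n : ℕ∞} :
    ContDiffAt ℝ n (signedPow p) x :=
  contDiffAt_id.mul ((contDiffAt_abs hx).rpow_const_of_ne (abs_pos.2 hx).ne')

theorem continuous_signedPow {p : ℝ} (hp : 0 < p) : Continuous (signedPow p) := by
  refine continuous_iff_continuousAt.2 fun x => ?_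
  rcases eq_or_ne x 0 with rfl | hx
  · have hpow : Continuous fun x : ℝ => |x| ^ p := continuous_abs.rpow_const fun _ => Or.inr hp.le
    rw [ContinuousAt, signedPow_zero]
    exact squeeze_zero_norm (fun y => (abs_signedPow hp.ne' y).le)
      (by simpa [hp.ne'] using hpow.tendsto 0)
  · exact (contDiffAt_signedPow p hx (n := 0)).continuousAt

theorem hasDerivAt_signedPow (p : ℝ) {x : ℝ} (hx : x ≠ 0) :
    HasDerivAt (signedPow p) (p * |x| ^ (p - 1)) x := by
  have hx' : 0 < |x| := abs_pos.2 hx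
  refine ((hasDerivAt_id x).mul ((hasDerivAt_abs hx).rpow_const (p := p - 1)
    (Or.inl hx'.ne'))).congr_deriv ?_
  have hpow : |x| ^ (p - 1 - 1) * |x| = |x| ^ (p - 1) := by
    rw [Real.rpow_sub_one hx'.ne', div_mul_cancel₀ _ hx'.ne']
  simp only [id]
  linear_combination (p - 1) * |x| ^ (p - 1 - 1) * self_mul_sign x + (p - 1) * hpow

theorem hasDerivAt_abs_rpow_add_one {q : ℝ} (hq : 0 < q) (x : ℝ) :
    HasDerivAt (fun x : ℝ => |x| ^ (q + 1)) ((q + 1) * signedPow q x) x := by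
  refine (hasDerivAt_abs_rpow x (by linarith : 1 < q + 1)).congr_deriv ?_
  rw [signedPow, show q + 1 - 2 = q - 1 by ring]
  ring

theorem rpow_one_sub_mul_signedPow {p q z : ℝ} (hp : 0 < p) :
    p ^ (1 - q) * signedPow q (p * z) = p * signedPow q z := by
  rw [signedPow_mul, signedPow_of_pos hp, ← mul_assoc, ← Real.rpow_add hp, sub_add_cancel,
    Real.rpow_one]

theorem signedPow_mul_sub_signedPow_mul_ne_zero {q x y : ℝ} (hq : q ≠ 1) (hx : x ≠ 0) (hy : y ≠ 0)
    (hxy : |x| ≠ |y|) : signedPow q x * y - signedPow q y * x ≠ 0 := by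
  have hfactor : signedPow q x * y - signedPow q y * x =
      x * y * (|x| ^ (q - 1) - |y| ^ (q - 1)) := by
    simp only [signedPow]
    ring
  rw [hfactor]
  refine mul_ne_zero (mul_ne_zero hx hy) (sub_ne_zero.2 fun h => hxy ?_)
  exact Real.rpow_left_injOn (sub_ne_zero.2 hq) (abs_nonneg x) (abs_nonneg y) h

/-! ### Generalized sine functions -/

theorem countable_sin_eq_zero : {s : ℝ | Real.sin s = 0}.Countable := by
  refine (countable_range fun n : ℤ => (n : ℝ) * Real.pi).mono fun s hs => ?_
  exact Real.sin_eq_zero_iff.1 hs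

theorem periodic_abs_sin_rpow (b : ℝ) :
    Function.Periodic (fun s => |Real.sin s| ^ b) Real.pi := fun s => by
  simp only [Real.sin_add_pi, abs_neg]

theorem intervalIntegrable_abs_sin_rpow_zero_pi_div_two {b : ℝ} (hb : -1 < b) (hb0 : b ≤ 0) :
    IntervalIntegrable (fun s => |Real.sin s| ^ b) volume 0 (Real.pi / 2) := by
  have hmeas : Measurable fun s => |Real.sin s| ^ b := by fun_prop
  refine ((intervalIntegral.intervalIntegrable_rpow' (a := 0) (b := Real.pi / 2)
    hb).const_mul ((2 / Real.pi) ^ b)).mono_fun hmeas.aestronglyMeasurable ?_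
  refine (ae_restrict_iff' measurableSet_uIoc).2 (Eventually.of_forall fun s hs => ?_)
  rw [uIoc_of_le (by positivity)] at hs
  have hslope : 0 < 2 / Real.pi := by positivity
  have hchord : 0 < 2 / Real.pi * s := mul_pos hslope hs.1
  have hjordan : 2 / Real.pi * s ≤ Real.sin s := Real.mul_le_sin hs.1.le hs.2
  beta_reduce
  rw [← Real.mul_rpow hslope.le hs.1.le, Real.norm_of_nonneg (Real.rpow_nonneg (abs_nonneg _) b),
    Real.norm_of_nonneg (Real.rpow_nonneg hchord.le b), abs_of_pos (hchord.trans_le hjordan)]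
  exact Real.rpow_le_rpow_of_nonpos hchord hjordan hb0

theorem intervalIntegrable_abs_sin_rpow {b : ℝ} (hb : -1 < b) (x y : ℝ) :
    IntervalIntegrable (fun s => |Real.sin s| ^ b) volume x y := by
  rcases le_or_gt 0 b with hb0 | hb0
  · exact (Real.continuous_sin.abs.rpow_const fun _ => Or.inr hb0).intervalIntegrable _ _
  · have hleft := intervalIntegrable_abs_sin_rpow_zero_pi_div_two hb hb0.le
    have hright : IntervalIntegrable (fun s => |Real.sin s| ^ b) volume (Real.pi / 2) Real.pi := by
      have hrefl := (hleft.comp_sub_left Real.pi).symm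
      simp only [Real.sin_pi_sub, sub_zero] at hrefl
      rwa [sub_half] at hrefl
    exact (periodic_abs_sin_rpow b).intervalIntegrable₀ Real.pi_ne_zero (hleft.trans hright) x y

theorem integral_abs_sin_rpow_pos {b : ℝ} (hb : -1 < b) {x y : ℝ} (hxy : x < y) :
    0 < ∫ s in x..y, |Real.sin s| ^ b := by
  rw [intervalIntegral.integral_pos_iff_support_of_nonneg_ae
    (Eventually.of_forall fun s => by positivity) (intervalIntegrable_abs_sin_rpow hb x y)]
  refine ⟨hxy, ?_⟩
  have hsupp : Ioc x y \ {s | Real.sin s = 0} ⊆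
      Function.support (fun s => |Real.sin s| ^ b) ∩ Ioc x y := fun s hs =>
    ⟨(Real.rpow_pos_of_pos (abs_pos.2 hs.2) _).ne', hs.1⟩
  refine lt_of_lt_of_le ?_ (measure_mono hsupp)
  rw [measure_sdiff_null (countable_sin_eq_zero.measure_zero _), Real.volume_Ioc]
  exact ENNReal.ofReal_pos.2 (sub_pos.2 hxy)

/-- The time needed to reach the phase `s` from the phase `0` when the phase moves with speed
`|sin| ^ (-b)`. -/
def arcTime (b s : ℝ) : ℝ := ∫ x in (0 : ℝ)..s, |Real.sin x| ^ b

/-- The phase reached at time `t`, that is, the inverse function of `arcTime b`. -/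
def phase (b : ℝ) : ℝ → ℝ := Function.invFun (arcTime b)

section Phase

variable {b : ℝ} (hb : -1 < b)
include hb

theorem strictMono_arcTime : StrictMono (arcTime b) := fun x y hxy => by
  have hadd : arcTime b x + ∫ s in x..y, |Real.sin s| ^ b = arcTime b y :=
    intervalIntegral.integral_add_adjacent_intervals
      (intervalIntegrable_abs_sin_rpow hb 0 x) (intervalIntegrable_abs_sin_rpow hb x y)
  linarith [integral_abs_sin_rpow_pos hb hxy]

theorem surjective_arcTime : Function.Surjective (arcTime b) := by
  have hpos := integral_abs_sin_rpow_pos hb Real.pi_pos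
  exact (intervalIntegral.continuous_primitive (intervalIntegrable_abs_sin_rpow hb) 0).surjective
    ((periodic_abs_sin_rpow b).tendsto_atTop_intervalIntegral_of_pos hpos Real.pi_pos)
    ((periodic_abs_sin_rpow b).tendsto_atBot_intervalIntegral_of_pos hpos Real.pi_pos)

theorem arcTime_add_two_pi (s : ℝ) :
    arcTime b (s + 2 * Real.pi) = arcTime b s + arcTime b (2 * Real.pi) := by
  have hper : Function.Periodic (fun s => |Real.sin s| ^ b) (2 * Real.pi) := fun s => by
    simp only [Real.sin_add_two_pi]
  simpa [arcTime] using
    hper.intervalIntegral_add_eq_add 0 s fun x y => intervalIntegrable_abs_sin_rpow hb x y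

theorem arcTime_int_mul_two_pi (n : ℤ) :
    arcTime b (n * (2 * Real.pi)) = n * arcTime b (2 * Real.pi) := by
  have hper : Function.Periodic (fun s => |Real.sin s| ^ b) (2 * Real.pi) := fun s => by
    simp only [Real.sin_add_two_pi]
  simpa [arcTime] using
    hper.intervalIntegral_add_zsmul_eq n 0 fun x y => intervalIntegrable_abs_sin_rpow hb x y

theorem hasDerivAt_arcTime {s : ℝ} (hs : Real.sin s ≠ 0) :
    HasDerivAt (arcTime b) (|Real.sin s| ^ b) s := by
  have hmeas : Measurable fun s => |Real.sin s| ^ b := by fun_prop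
  exact intervalIntegral.integral_hasDerivAt_right (intervalIntegrable_abs_sin_rpow hb 0 s)
    hmeas.stronglyMeasurable.stronglyMeasurableAtFilter
    (Real.continuous_sin.continuousAt.abs.rpow_const (Or.inl (abs_pos.2 hs).ne'))

theorem phase_arcTime (s : ℝ) : phase b (arcTime b s) = s :=
  Function.leftInverse_invFun (strictMono_arcTime hb).injective s

theorem arcTime_phase (t : ℝ) : arcTime b (phase b t) = t :=
  Function.rightInverse_invFun (surjective_arcTime hb) t

theorem phase_zero : phase b 0 = 0 := by
  simpa [arcTime] using phase_arcTime hb 0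

theorem phase_add_arcTime_two_pi (t : ℝ) :
    phase b (t + arcTime b (2 * Real.pi)) = phase b t + 2 * Real.pi := by
  rw [← phase_arcTime hb (phase b t + 2 * Real.pi), arcTime_add_two_pi hb, arcTime_phase hb]

theorem strictMono_phase : StrictMono (phase b) := fun x y hxy => by
  rwa [← (strictMono_arcTime hb).lt_iff_lt, arcTime_phase hb, arcTime_phase hb]

theorem continuous_phase : Continuous (phase b) :=
  (strictMono_phase hb).monotone.continuous_of_surjective fun s => ⟨_, phase_arcTime hb s⟩

theorem hasDerivAt_phase {t : ℝ} (ht : Real.sin (phase b t) ≠ 0) :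
    HasDerivAt (phase b) (|Real.sin (phase b t)| ^ (-b)) t := by
  rw [Real.rpow_neg (abs_nonneg _)]
  exact (hasDerivAt_arcTime hb ht).of_local_left_inverse (continuous_phase hb).continuousAt
    (Real.rpow_pos_of_pos (abs_pos.2 ht) _).ne' (Eventually.of_forall (arcTime_phase hb))

theorem countable_sin_phase_eq_zero : {t | Real.sin (phase b t) = 0}.Countable :=
  countable_sin_eq_zero.preimage_of_injOn (strictMono_phase hb).injective.injOn

end Phase

theorem periodic_deriv {f : ℝ → ℝ} {P : ℝ} (hf : Function.Periodic f P) :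
    Function.Periodic (deriv f) P := fun t => by
  rw [← deriv_comp_add_const, funext hf]

theorem hasDerivAt_of_hasDerivAt_off_countable {E : Type*} [NormedAddCommGroup E]
    [NormedSpace ℝ E] [CompleteSpace E] {f g : ℝ → E} {s : Set ℝ} (hs : s.Countable)
    (hf : Continuous f) (hg : Continuous g) (h : ∀ t ∉ s, HasDerivAt f (g t) t) (t : ℝ) :
    HasDerivAt f (g t) t := by
  have hprim (x : ℝ) : f x = f 0 + ∫ y in (0 : ℝ)..x, g y := by
    rw [MeasureTheory.integral_eq_of_hasDerivAt_off_countable f g hs hf.continuousOn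
      (fun y hy => h y hy.2) (hg.intervalIntegrable _ _), add_sub_cancel]
  rw [funext hprim]
  exact (hg.integral_hasStrictDerivAt 0 t).hasDerivAt.const_add _

/-- The generalized sine: the solution of `S'' = -2 / (q + 1) S |S| ^ (q - 1)` with `S 0 = 0` and
maximum `1`. It is parametrized by the phase in which the orbit `|S| ^ (q + 1) + C ^ 2 = 1` of
`(S, C)`, where `C = genCos q`, becomes a circle. -/
def genSin (q t : ℝ) : ℝ := signedPow (2 / (q + 1)) (Real.sin (phase (2 / (q + 1) - 1) t))

/-- The generalized cosine, proportional to the derivative of `genSin q`. -/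
def genCos (q t : ℝ) : ℝ := Real.cos (phase (2 / (q + 1) - 1) t)

/-- The least period of `genSin q`. -/
def genPeriod (q : ℝ) : ℝ := arcTime (2 / (q + 1) - 1) (2 * Real.pi)

section GenSin

variable {q : ℝ} (hq : 0 < q)
include hq

theorem neg_one_lt_two_div_add_one_sub_one : -1 < 2 / (q + 1) - 1 := by
  have : 0 < 2 / (q + 1) := by positivity
  linarith

theorem genPeriod_pos : 0 < genPeriod q :=
  integral_abs_sin_rpow_pos (neg_one_lt_two_div_add_one_sub_one hq) Real.two_pi_pos

@[simp]
theorem genSin_zero : genSin q 0 = 0 := by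
  simp [genSin, phase_zero (neg_one_lt_two_div_add_one_sub_one hq)]

@[simp]
theorem genCos_zero : genCos q 0 = 1 := by
  simp [genCos, phase_zero (neg_one_lt_two_div_add_one_sub_one hq)]

theorem continuous_genSin : Continuous (genSin q) :=
  (continuous_signedPow (by positivity)).comp (Real.continuous_sin.comp
    (continuous_phase (neg_one_lt_two_div_add_one_sub_one hq)))

theorem continuous_genCos : Continuous (genCos q) :=
  Real.continuous_cos.comp (continuous_phase (neg_one_lt_two_div_add_one_sub_one hq))

theorem hasDerivAt_genSin (t : ℝ) : HasDerivAt (genSin q) (2 / (q + 1) * genCos q t) t := by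
  have hb := neg_one_lt_two_div_add_one_sub_one hq
  refine hasDerivAt_of_hasDerivAt_off_countable (g := fun t => 2 / (q + 1) * genCos q t)
    (countable_sin_phase_eq_zero hb) (continuous_genSin hq)
    (continuous_const.mul (continuous_genCos hq)) (fun t ht => ?_) t
  refine ((hasDerivAt_signedPow _ ht).comp t
    ((Real.hasDerivAt_sin _).comp t (hasDerivAt_phase hb ht))).congr_deriv ?_
  have hpow := mul_inv_cancel₀ (Real.rpow_pos_of_pos (abs_pos.2 ht) (2 / (q + 1) - 1)).ne'
  rw [Real.rpow_neg (abs_nonneg _), genCos]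
  linear_combination 2 / (q + 1) * Real.cos (phase (2 / (q + 1) - 1) t) * hpow

theorem hasDerivAt_genCos (t : ℝ) : HasDerivAt (genCos q) (-signedPow q (genSin q t)) t := by
  have hb := neg_one_lt_two_div_add_one_sub_one hq
  refine hasDerivAt_of_hasDerivAt_off_countable (g := fun t => -signedPow q (genSin q t))
    (countable_sin_phase_eq_zero hb) (continuous_genCos hq)
    ((continuous_signedPow hq).comp (continuous_genSin hq)).neg (fun t ht => ?_) t
  refine ((Real.hasDerivAt_cos _).comp t (hasDerivAt_phase hb ht)).congr_deriv ?_
  have hexp : -(2 / (q + 1) - 1) = 2 / (q + 1) * q - 1 := by field_simp; ring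
  rw [genSin, signedPow_signedPow, signedPow, hexp, neg_mul]

theorem periodic_genSin_genPeriod : Function.Periodic (genSin q) (genPeriod q) := fun t => by
  simp only [genSin, genPeriod, phase_add_arcTime_two_pi (neg_one_lt_two_div_add_one_sub_one hq),
    Real.sin_add_two_pi]

theorem periodic_genSin_iff {P : ℝ} :
    Function.Periodic (genSin q) P ↔ ∃ n : ℤ, P = n * genPeriod q := by
  have hb := neg_one_lt_two_div_add_one_sub_one hq
  refine ⟨fun hP => ?_, ?_⟩
  · -- A period of `genSin` is a period of its derivative, so the phase returns to the angle `0`.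
    have hcos : genCos q P = genCos q 0 := by
      have hderiv := (periodic_deriv hP).eq
      rw [(hasDerivAt_genSin hq P).deriv, (hasDerivAt_genSin hq 0).deriv] at hderiv
      exact mul_left_cancel₀ (by positivity) hderiv
    rw [genCos_zero hq] at hcos
    obtain ⟨n, hn⟩ := (Real.cos_eq_one_iff _).1 hcos
    refine ⟨n, ?_⟩
    rw [genPeriod, ← arcTime_int_mul_two_pi hb, hn, arcTime_phase hb]
  · rintro ⟨n, rfl⟩
    exact (periodic_genSin_genPeriod hq).int_mul n

theorem isSignChanging_genSin : IsSignChanging (genSin q) := by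
  have hb := neg_one_lt_two_div_add_one_sub_one hq
  refine ⟨⟨arcTime (2 / (q + 1) - 1) (Real.pi / 2), ?_⟩,
    ⟨arcTime (2 / (q + 1) - 1) (-(Real.pi / 2)), ?_⟩⟩
  · simp [genSin, phase_arcTime hb]
  · simp [genSin, phase_arcTime hb, signedPow_neg]

end GenSin

/-! ### The angular equation -/

theorem eventuallyEq_of_contDiffAt_field {E : Type*} [NormedAddCommGroup E] [NormedSpace ℝ E]
    {F : E → E} {f g : ℝ → E} {t : ℝ} (hF : ContDiffAt ℝ 1 F (f t))
    (hf : ∀ᶠ x in 𝓝 t, HasDerivAt f (F (f x)) x) (hg : ∀ᶠ x in 𝓝 t, HasDerivAt g (F (g x)) x)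
    (heq : f t = g t) : f =ᶠ[𝓝 t] g := by
  obtain ⟨K, s, hs, hK⟩ := hF.exists_lipschitzOnWith
  have hfs := hf.self_of_nhds.continuousAt.eventually_mem hs
  have hgs := hg.self_of_nhds.continuousAt.eventually_mem (heq ▸ hs)
  exact ODE_solution_unique_of_eventually (v := fun _ => F) (s := fun _ => s)
    (Eventually.of_forall fun _ => hK) (hf.and hfs) (hg.and hgs) heq

/-- The conserved quantity `w' ^ 2 + μ w ^ 2 - 2 ε / (q + 1) |w| ^ (q + 1)` of the equation
`w'' + μ w = ε w |w| ^ (q - 1)`. -/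
def energy (μ ε q : ℝ) (w : ℝ → ℝ) (t : ℝ) : ℝ :=
  deriv w t ^ 2 + μ * w t ^ 2 - 2 * ε / (q + 1) * |w t| ^ (q + 1)

section Equation

variable {μ ε q : ℝ} {v w : ℝ → ℝ}

theorem IsODESolution.hasDerivAt (hw : IsODESolution μ ε q w) (t : ℝ) :
    HasDerivAt w (deriv w t) t :=
  (hw.1.differentiable two_ne_zero t).hasDerivAt

theorem IsODESolution.hasDerivAt_deriv (hw : IsODESolution μ ε q w) (t : ℝ) :
    HasDerivAt (deriv w) (ε * signedPow q (w t) - μ * w t) t := by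
  rw [signedPow, ← hw.2 t, add_sub_cancel_right]
  exact (hw.1.differentiable_deriv_two t).hasDerivAt

theorem isODESolution_of_hasDerivAt (hq : 0 < q) {w' : ℝ → ℝ} (hw : ∀ t, HasDerivAt w (w' t) t)
    (hw' : ∀ t, HasDerivAt w' (ε * signedPow q (w t) - μ * w t) t) : IsODESolution μ ε q w := by
  have hderiv : deriv w = w' := funext fun t => (hw t).deriv
  have hderiv₂ : deriv w' = fun t => ε * signedPow q (w t) - μ * w t :=
    funext fun t => (hw' t).deriv
  have hdiff : Differentiable ℝ w := fun t => (hw t).differentiableAt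
  refine ⟨?_, fun t => ?_⟩
  · rw [← one_add_one_eq_two, contDiff_succ_iff_deriv, hderiv, contDiff_one_iff_deriv, hderiv₂]
    refine ⟨hdiff, by simp, fun t => (hw' t).differentiableAt, ?_⟩
    exact (continuous_const.mul ((continuous_signedPow hq).comp hdiff.continuous)).sub
      (continuous_const.mul hdiff.continuous)
  · rw [hderiv, hderiv₂, sub_add_cancel, signedPow]

theorem IsODESolution.energy_eq (hq : 0 < q) (hw : IsODESolution μ ε q w) (s t : ℝ) :
    energy μ ε q w s = energy μ ε q w t := by
  have hconst (t : ℝ) : HasDerivAt (energy μ ε q w) 0 t := by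
    refine ((((hw.hasDerivAt_deriv t).pow 2).add (((hw.hasDerivAt t).pow 2).const_mul μ)).sub
      (((hasDerivAt_abs_rpow_add_one hq (w t)).comp t (hw.hasDerivAt t)).const_mul
        (2 * ε / (q + 1)))).congr_deriv ?_
    simp only [Nat.cast_ofNat, Nat.add_one_sub_one, pow_one]
    field_simp
    ring
  exact is_const_of_deriv_eq_zero (fun t => (hconst t).differentiableAt)
    (fun t => (hconst t).deriv) s t

theorem energy_of_eq_zero (hq : 0 < q) {t : ℝ} (h : w t = 0) :
    energy μ ε q w t = deriv w t ^ 2 := by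
  simp [energy, h, Real.zero_rpow (by linarith : q + 1 ≠ 0)]

theorem IsODESolution.eventuallyEq_of_ne_zero (hv : IsODESolution μ ε q v)
    (hw : IsODESolution μ ε q w) {t : ℝ} (h : v t = w t) (h' : deriv v t = deriv w t)
    (hne : v t ≠ 0) : v =ᶠ[𝓝 t] w := by
  have hF : ContDiffAt ℝ 1 (fun z : ℝ × ℝ => (z.2, ε * signedPow q z.1 - μ * z.1))
      (v t, deriv v t) :=
    contDiffAt_snd.prodMk ((contDiffAt_const.mul
      (ContDiffAt.comp (v t, deriv v t) (contDiffAt_signedPow q hne) contDiffAt_fst)).sub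
      (contDiffAt_const.mul contDiffAt_fst))
  have hcurve {f : ℝ → ℝ} (hf : IsODESolution μ ε q f) (x : ℝ) :
      HasDerivAt (fun x => (f x, deriv f x)) (deriv f x, ε * signedPow q (f x) - μ * f x) x :=
    (hf.hasDerivAt x).prodMk (hf.hasDerivAt_deriv x)
  have hpair : (fun x => (v x, deriv v x)) =ᶠ[𝓝 t] fun x => (w x, deriv w x) :=
    eventuallyEq_of_contDiffAt_field hF (Eventually.of_forall (hcurve hv))
      (Eventually.of_forall (hcurve hw)) (Prod.ext h h')
  exact hpair.fun_comp Prod.fst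

/- For `q < 1` the nonlinearity is not Lipschitz at `0`. When the slope does not vanish, energy
conservation turns the equation into `w' = ± √(…)`, whose right-hand side is `C¹` in `w` since
`q + 1 > 1`. -/
theorem IsODESolution.eventuallyEq_of_eq_zero (hq : 0 < q) (hv : IsODESolution μ ε q v)
    (hw : IsODESolution μ ε q w) {t : ℝ} (hvt : v t = 0) (hwt : w t = 0)
    (h' : deriv v t = deriv w t) (hne : deriv v t ≠ 0) : v =ᶠ[𝓝 t] w := by
  set a := deriv v t with ha
  set G : ℝ → ℝ := fun x => SignType.sign a *
    √(a ^ 2 - μ * x ^ 2 + 2 * ε / (q + 1) * |x| ^ (q + 1)) with hGdef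
  have hG : ContDiffAt ℝ 1 G (v t) := by
    have hpow : ContDiff ℝ 1 fun x : ℝ => |x| ^ (q + 1) := contDiff_norm_rpow (by linarith)
    refine contDiffAt_const.mul (ContDiffAt.sqrt (by fun_prop) ?_)
    simpa [hvt, Real.zero_rpow (by linarith : q + 1 ≠ 0)] using hne
  have hfirst {f : ℝ → ℝ} (hf : IsODESolution μ ε q f) (hft : f t = 0) (hfa : deriv f t = a) :
      ∀ᶠ x in 𝓝 t, HasDerivAt f (G (f x)) x := by
    have hsign : ∀ᶠ x in 𝓝 t, SignType.sign (deriv f x) = SignType.sign a := by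
      rw [← hfa] at hne ⊢
      exact ((continuousAt_sign_of_ne_zero hne).comp
        (hf.hasDerivAt_deriv t).continuousAt).eventually_mem (mem_nhds_discrete.2 (mem_singleton _))
    filter_upwards [hsign] with x hx
    have henergy : energy μ ε q f x = a ^ 2 := by
      rw [hf.energy_eq hq x t, energy_of_eq_zero hq hft, hfa]
    convert hf.hasDerivAt x using 1
    rw [hGdef, ← henergy, ← hx]
    simp only [energy]
    rw [show deriv f x ^ 2 + μ * f x ^ 2 - 2 * ε / (q + 1) * |f x| ^ (q + 1) - μ * f x ^ 2 +
      2 * ε / (q + 1) * |f x| ^ (q + 1) = deriv f x ^ 2 by ring, Real.sqrt_sq_eq_abs, sign_mul_abs]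
  exact eventuallyEq_of_contDiffAt_field hG (hfirst hv hvt ha.symm) (hfirst hw hwt h'.symm)
    (hvt.trans hwt.symm)

theorem IsODESolution.eq_of_energy_ne_zero (hq : 0 < q) (hv : IsODESolution μ ε q v)
    (hw : IsODESolution μ ε q w) {t₀ : ℝ} (h : v t₀ = w t₀) (h' : deriv v t₀ = deriv w t₀)
    (hne : energy μ ε q v t₀ ≠ 0) : v = w := by
  set A : Set ℝ := {t | v t = w t ∧ deriv v t = deriv w t}
  have hclosed : IsClosed A :=
    (isClosed_eq hv.1.continuous hw.1.continuous).inter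
      (isClosed_eq hv.1.differentiable_deriv_two.continuous
        hw.1.differentiable_deriv_two.continuous)
  have hopen : IsOpen A := isOpen_iff_mem_nhds.2 fun t ⟨ht, ht'⟩ => by
    have hloc : v =ᶠ[𝓝 t] w := by
      by_cases hvt : v t = 0
      · have hslope : deriv v t ^ 2 ≠ 0 := by
          rwa [← energy_of_eq_zero (μ := μ) (ε := ε) hq hvt, hv.energy_eq hq t t₀]
        exact hv.eventuallyEq_of_eq_zero hq hw hvt (ht ▸ hvt) ht' (pow_ne_zero_iff two_ne_zero |>.1
          hslope)
      · exact hv.eventuallyEq_of_ne_zero hw ht ht' hvt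
    filter_upwards [hloc, hloc.deriv] with x hx hx' using ⟨hx, hx'⟩
  have huniv : A = univ := IsClopen.eq_univ ⟨hclosed, hopen⟩ ⟨t₀, h, h'⟩
  exact funext fun t => (huniv ▸ mem_univ t : t ∈ A).1

theorem IsODESolution.eq_zero_of_deriv_eq_zero (hq : 0 < q) (hμ : 0 ≤ μ) (hε : ε < 0)
    (hw : IsODESolution μ ε q w) {t₀ : ℝ} (h : w t₀ = 0) (h' : deriv w t₀ = 0) (t : ℝ) :
    w t = 0 := by
  have henergy : energy μ ε q w t = 0 := by
    rw [hw.energy_eq hq t t₀, energy_of_eq_zero hq h, h', zero_pow two_ne_zero]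
  by_contra hne
  have hcoeff : 0 < -(2 * ε / (q + 1)) := by
    rw [← neg_div]
    exact div_pos (by linarith) (by linarith)
  have hpot := mul_pos hcoeff (Real.rpow_pos_of_pos (abs_pos.2 hne) (q + 1))
  rw [energy] at henergy
  linarith [sq_nonneg (deriv w t), mul_nonneg hμ (sq_nonneg (w t))]

end Equation

theorem eq_of_monotone_of_periodic {f : ℝ → ℝ} {P : ℝ} (hP : 0 < P) (hf : Monotone f)
    (hper : Function.Periodic f P) (x y : ℝ) : f x = f y := by
  wlog hxy : x ≤ y generalizing x y
  · exact (this y x (le_of_not_ge hxy)).symm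
  refine (hf hxy).antisymm ?_
  obtain ⟨n, hn⟩ := exists_nat_ge ((y - x) / P)
  rw [div_le_iff₀ hP, sub_le_iff_le_add'] at hn
  exact (hf hn).trans_eq (hper.nat_mul n x)

theorem eq_zero_of_hasDerivAt_of_periodic {f f' : ℝ → ℝ} {P : ℝ} (hP : 0 < P)
    (hf : ∀ t, HasDerivAt f (f' t) t) (hper : Function.Periodic f P) (hf' : 0 ≤ f') : f' = 0 := by
  have hmono : Monotone f := monotone_of_hasDerivAt_nonneg hf hf'
  funext t
  have hconst : f = fun _ => f t := funext fun x => eq_of_monotone_of_periodic hP hmono hper x t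
  exact (hf t).unique (hconst ▸ hasDerivAt_const t (f t))

/-- The function `± w` translated by `φ`; the sign `s` is meant to be `1` or `-1`. -/
def signedTranslate (s φ : ℝ) (w : ℝ → ℝ) (θ : ℝ) : ℝ := s * w (θ - φ)

theorem deriv_signedTranslate (s φ : ℝ) (w : ℝ → ℝ) :
    deriv (signedTranslate s φ w) = signedTranslate s φ (deriv w) := funext fun t => by
  rw [signedTranslate, ← deriv_comp_sub_const]
  exact deriv_const_mul_field s

theorem signedTranslate_neg_signedTranslate {s φ : ℝ} (hs : s = 1 ∨ s = -1) {w : ℝ → ℝ} :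
    signedTranslate s (-φ) (signedTranslate s φ w) = w := funext fun t => by
  rcases hs with rfl | rfl <;> simp [signedTranslate]

theorem periodic_signedTranslate_iff {s φ P : ℝ} (hs : s ≠ 0) {w : ℝ → ℝ} :
    Function.Periodic (signedTranslate s φ w) P ↔ Function.Periodic w P := by
  refine ⟨fun h t => ?_, fun h t => ?_⟩
  · have := h (t + φ)
    simp only [signedTranslate] at this
    rw [add_right_comm, add_sub_cancel_right, add_sub_cancel_right] at this
    exact mul_left_cancel₀ hs this
  · rw [signedTranslate, add_sub_right_comm, h, signedTranslate]

section Periodic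

variable {μ ε q s φ P : ℝ} {w : ℝ → ℝ}

theorem isODESolution_signedTranslate (hs : s = 1 ∨ s = -1) (hw : IsODESolution μ ε q w) :
    IsODESolution μ ε q (signedTranslate s φ w) := by
  refine ⟨contDiff_const.mul (hw.1.comp (contDiff_id.sub contDiff_const)), fun t => ?_⟩
  have habs : |signedTranslate s φ w t| = |w (t - φ)| := by
    rcases hs with rfl | rfl <;> simp [signedTranslate]
  rw [habs, deriv_signedTranslate, deriv_signedTranslate]
  simp only [signedTranslate]
  linear_combination s * hw.2 (t - φ)

theorem IsODESolution.eq_of_periodic (hμ : μ ≤ 0) (hε : 0 ≤ ε) (hw : IsODESolution μ ε q w)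
    (hP : 0 < P) (hper : Function.Periodic w P) (x y : ℝ) : w x = w y := by
  have hpot (t : ℝ) : 0 ≤ w t * (ε * signedPow q (w t) - μ * w t) := by
    nlinarith [mul_nonneg hε (mul_signedPow_nonneg q (w t)), mul_nonneg (neg_nonneg.2 hμ)
      (mul_self_nonneg (w t))]
  have hzero := eq_zero_of_hasDerivAt_of_periodic hP
    (fun t => (hw.hasDerivAt t).mul (hw.hasDerivAt_deriv t)) (hper.mul (periodic_deriv hper))
    (fun t => add_nonneg (mul_self_nonneg (deriv w t)) (hpot t))
  refine is_const_of_deriv_eq_zero (fun t => (hw.hasDerivAt t).differentiableAt) (fun t => ?_) x y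
  have ht : deriv w t * deriv w t + w t * (ε * signedPow q (w t) - μ * w t) = 0 :=
    congrFun hzero t
  exact mul_self_eq_zero.1 (by linarith [hpot t, mul_self_nonneg (deriv w t)])

theorem IsODESolution.exists_pos_of_periodic (hμ : 0 ≤ μ) (hε : ε < 0)
    (hw : IsODESolution μ ε q w) (hP : 0 < P) (hper : Function.Periodic w P)
    (hne : ∃ t, w t ≠ 0) : ∃ t, 0 < w t := by
  by_contra! hnonpos
  have hforce (t : ℝ) : 0 ≤ ε * signedPow q (w t) :=
    mul_nonneg_of_nonpos_of_nonpos hε.le (signedPow_nonpos q (hnonpos t))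
  have hlinear (t : ℝ) : 0 ≤ -(μ * w t) :=
    neg_nonneg.2 (mul_nonpos_of_nonneg_of_nonpos hμ (hnonpos t))
  have hzero := eq_zero_of_hasDerivAt_of_periodic hP hw.hasDerivAt_deriv (periodic_deriv hper)
    (fun t => add_nonneg (hforce t) (hlinear t))
  obtain ⟨t, ht⟩ := hne
  have hsum : ε * signedPow q (w t) - μ * w t = 0 := congrFun hzero t
  have hpow : ε * signedPow q (w t) = 0 := by linarith [hforce t, hlinear t]
  exact ht (signedPow_eq_zero.1 ((mul_eq_zero.1 hpow).resolve_left hε.ne))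

theorem IsODESolution.isSignChanging_of_periodic (hμ : 0 ≤ μ) (hε : ε < 0)
    (hw : IsODESolution μ ε q w) (hP : 0 < P) (hper : Function.Periodic w P)
    (hne : ∃ t, w t ≠ 0) : IsSignChanging w := by
  refine ⟨hw.exists_pos_of_periodic hμ hε hP hper hne, ?_⟩
  have hneg := isODESolution_signedTranslate (φ := 0) (Or.inr rfl) hw
  obtain ⟨t, ht⟩ := hneg.exists_pos_of_periodic hμ hε hP
    ((periodic_signedTranslate_iff (by norm_num)).2 hper)
    (hne.imp fun t ht => by simpa [signedTranslate] using ht)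
  exact ⟨t, by simpa [signedTranslate] using ht⟩

end Periodic

/-! ### Angular modes -/

/-- The frequency of `oscillation q ρ`, relative to `genSin q`. -/
def frequency (q ρ : ℝ) : ℝ := √((q + 1) / 2 * ρ ^ (q - 1))

/-- The solution of `w'' = -w |w| ^ (q - 1)` of amplitude `ρ` that vanishes at `0` with positive
slope. -/
def oscillation (q ρ t : ℝ) : ℝ := ρ * genSin q (frequency q ρ * t)

/-- The inverse function of `frequency q`, for `q ≠ 1`. -/
def amplitude (q c : ℝ) : ℝ := (2 / (q + 1) * c ^ 2) ^ (q - 1)⁻¹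

/-- The oscillation of least period `2 π / k`. -/
def angularMode (q : ℝ) (k : ℕ) : ℝ → ℝ :=
  oscillation q (amplitude q (k * genPeriod q / (2 * Real.pi)))

section Oscillation

variable {q ρ : ℝ} (hq : 0 < q)
include hq

theorem frequency_pos (hρ : 0 < ρ) : 0 < frequency q ρ := Real.sqrt_pos.2 (by positivity)

theorem frequency_sq (hρ : 0 < ρ) : frequency q ρ ^ 2 = (q + 1) / 2 * ρ ^ (q - 1) :=
  Real.sq_sqrt (by positivity)

theorem frequency_amplitude (hq₁ : q ≠ 1) {c : ℝ} (hc : 0 < c) :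
    frequency q (amplitude q c) = c := by
  rw [frequency, amplitude, Real.rpow_inv_rpow (by positivity) (sub_ne_zero.2 hq₁),
    show (q + 1) / 2 * (2 / (q + 1) * c ^ 2) = c ^ 2 by field_simp, Real.sqrt_sq hc.le]

theorem amplitude_frequency (hq₁ : q ≠ 1) (hρ : 0 < ρ) : amplitude q (frequency q ρ) = ρ := by
  rw [amplitude, frequency_sq hq hρ,
    show 2 / (q + 1) * ((q + 1) / 2 * ρ ^ (q - 1)) = ρ ^ (q - 1) by field_simp,
    Real.rpow_rpow_inv hρ.le (sub_ne_zero.2 hq₁)]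

theorem oscillation_zero : oscillation q ρ 0 = 0 := by
  simp [oscillation, genSin_zero hq]

theorem hasDerivAt_oscillation (t : ℝ) :
    HasDerivAt (oscillation q ρ)
      (2 / (q + 1) * ρ * frequency q ρ * genCos q (frequency q ρ * t)) t := by
  refine (((hasDerivAt_genSin hq _).comp t
    ((hasDerivAt_id t).const_mul (frequency q ρ))).const_mul ρ).congr_deriv ?_
  simp only [id]
  ring

theorem isODESolution_oscillation (hρ : 0 < ρ) : IsODESolution 0 (-1) q (oscillation q ρ) := by
  refine isODESolution_of_hasDerivAt hq (hasDerivAt_oscillation hq) fun t => ?_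
  refine (((hasDerivAt_genCos hq _).comp t ((hasDerivAt_id t).const_mul
    (frequency q ρ))).const_mul (2 / (q + 1) * ρ * frequency q ρ)).congr_deriv ?_
  have hscale : 2 / (q + 1) * ρ * frequency q ρ ^ 2 = ρ ^ q := by
    rw [frequency_sq hq hρ, Real.rpow_sub_one hρ.ne']
    field_simp
  rw [oscillation, signedPow_mul, signedPow_of_pos hρ, ← hscale]
  simp only [id]
  ring

theorem isSignChanging_oscillation (hρ : 0 < ρ) : IsSignChanging (oscillation q ρ) := by
  obtain ⟨⟨a, ha⟩, b, hb⟩ := isSignChanging_genSin hq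
  have hfreq := (frequency_pos hq hρ).ne'
  refine ⟨⟨a / frequency q ρ, ?_⟩, b / frequency q ρ, ?_⟩
  · rw [oscillation, mul_div_cancel₀ _ hfreq]
    exact mul_pos hρ ha
  · rw [oscillation, mul_div_cancel₀ _ hfreq]
    exact mul_neg_of_pos_of_neg hρ hb

theorem periodic_oscillation_iff (hρ : 0 < ρ) {P : ℝ} :
    Function.Periodic (oscillation q ρ) P ↔ ∃ n : ℤ, frequency q ρ * P = n * genPeriod q := by
  rw [← periodic_genSin_iff hq]
  have hfreq := (frequency_pos hq hρ).ne'
  refine ⟨fun h t => ?_, fun h t => ?_⟩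
  · have hshift := mul_left_cancel₀ hρ.ne' (h (t / frequency q ρ))
    rwa [mul_add, mul_div_cancel₀ _ hfreq] at hshift
  · rw [oscillation, mul_add, h, oscillation]

theorem hasLeastPeriod_oscillation (hρ : 0 < ρ) :
    HasLeastPeriod (oscillation q ρ) (genPeriod q / frequency q ρ) := by
  have hfreq := frequency_pos hq hρ
  have hperiod := genPeriod_pos hq
  refine ⟨⟨div_pos hperiod hfreq, (periodic_oscillation_iff hq hρ).2 ⟨1, ?_⟩⟩, ?_⟩
  · rw [mul_div_cancel₀ _ hfreq.ne', Int.cast_one, one_mul]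
  · rintro P ⟨hP, hper⟩
    obtain ⟨n, hn⟩ := (periodic_oscillation_iff hq hρ).1 hper
    have hn_pos : 0 < n := by
      exact_mod_cast pos_of_mul_pos_left (hn ▸ mul_pos hfreq hP) hperiod.le
    rw [div_le_iff₀' hfreq, hn]
    exact le_mul_of_one_le_left hperiod.le (by exact_mod_cast hn_pos)

theorem isAngularMode_oscillation_iff (hρ : 0 < ρ) {k : ℕ} (hk : 1 ≤ k) :
    IsAngularMode q k (oscillation q ρ) ↔ frequency q ρ = k * genPeriod q / (2 * Real.pi) := by
  have hk_pos : (0 : ℝ) < k := by exact_mod_cast hk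
  have hfreq := frequency_pos hq hρ
  have hleast := hasLeastPeriod_oscillation hq hρ
  have hiff : genPeriod q / frequency q ρ = 2 * Real.pi / k ↔
      frequency q ρ = k * genPeriod q / (2 * Real.pi) := by
    rw [div_eq_div_iff hfreq.ne' hk_pos.ne', eq_div_iff Real.two_pi_pos.ne', mul_comm (k : ℝ),
      mul_comm (2 * Real.pi), eq_comm]
  rw [← hiff]
  exact ⟨fun h => hleast.unique h.2.2, fun h => ⟨isODESolution_oscillation hq hρ,
    isSignChanging_oscillation hq hρ, h ▸ hleast⟩⟩

theorem exists_eq_signedTranslate_oscillation {v : ℝ → ℝ} (hv : IsODESolution 0 (-1) q v) {φ : ℝ}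
    (hφ : v φ = 0) (hne : ∃ t, v t ≠ 0) :
    ∃ ρ s : ℝ, 0 < ρ ∧ (s = 1 ∨ s = -1) ∧ v = signedTranslate s φ (oscillation q ρ) := by
  have hslope : deriv v φ ≠ 0 := fun h => by
    obtain ⟨t, ht⟩ := hne
    exact ht (hv.eq_zero_of_deriv_eq_zero hq le_rfl (by norm_num) hφ h t)
  obtain ⟨s, hs, hs_slope⟩ : ∃ s : ℝ, (s = 1 ∨ s = -1) ∧ deriv v φ = s * |deriv v φ| := by
    rcases abs_choice (deriv v φ) with h | h
    · exact ⟨1, Or.inl rfl, by rw [h, one_mul]⟩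
    · exact ⟨-1, Or.inr rfl, by rw [h, neg_one_mul, neg_neg]⟩
  -- The energy `deriv v φ ^ 2` equals `2 / (q + 1) * ρ ^ (q + 1)`.
  set ρ : ℝ := ((q + 1) / 2 * deriv v φ ^ 2) ^ (q + 1)⁻¹
  have hρ : 0 < ρ := by positivity
  have hρ_pow : ρ ^ (q + 1) = (q + 1) / 2 * deriv v φ ^ 2 :=
    Real.rpow_inv_rpow (by positivity) (by linarith)
  have hρ_slope : 2 / (q + 1) * ρ * frequency q ρ = |deriv v φ| := by
    refine (pow_left_inj₀ (mul_pos (by positivity) (frequency_pos hq hρ)).le (abs_nonneg _)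
      two_ne_zero).1 ?_
    rw [mul_pow, frequency_sq hq hρ, sq_abs, Real.rpow_sub_one hρ.ne']
    rw [Real.rpow_add_one hρ.ne'] at hρ_pow
    field_simp at hρ_pow ⊢
    linear_combination hρ_pow
  refine ⟨ρ, s, hρ, hs, hv.eq_of_energy_ne_zero hq
    (isODESolution_signedTranslate hs (isODESolution_oscillation hq hρ)) (t₀ := φ) ?_ ?_ ?_⟩
  · rw [hφ, signedTranslate, sub_self, oscillation_zero hq, mul_zero]
  · rw [deriv_signedTranslate, signedTranslate, sub_self, (hasDerivAt_oscillation hq 0).deriv,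
      mul_zero, genCos_zero hq, mul_one, hρ_slope]
    exact hs_slope
  · rw [energy_of_eq_zero hq hφ]
    exact pow_ne_zero 2 hslope

end Oscillation

section AngularMode

variable {q s φ : ℝ} {j k : ℕ} {w : ℝ → ℝ}

theorem IsAngularMode.index_unique (hj : 1 ≤ j) (hk : 1 ≤ k) (h : IsAngularMode q j w)
    (h' : IsAngularMode q k w) : j = k := by
  have hperiod : 2 * Real.pi / j = 2 * Real.pi / k := h.2.2.unique h'.2.2
  have hj_ne : (j : ℝ) ≠ 0 := by exact_mod_cast (Nat.one_le_iff_ne_zero.1 hj)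
  have hk_ne : (k : ℝ) ≠ 0 := by exact_mod_cast (Nat.one_le_iff_ne_zero.1 hk)
  rw [div_eq_div_iff hj_ne hk_ne] at hperiod
  exact_mod_cast (mul_left_cancel₀ Real.two_pi_pos.ne' hperiod).symm

theorem IsSignChanging.exists_eq_zero (h : IsSignChanging w) (hw : Continuous w) :
    ∃ φ, w φ = 0 := by
  obtain ⟨⟨a, ha⟩, b, hb⟩ := h
  exact mem_range_of_exists_le_of_exists_ge hw ⟨b, hb.le⟩ ⟨a, ha.le⟩

theorem isSignChanging_signedTranslate (hs : s = 1 ∨ s = -1) (h : IsSignChanging w) :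
    IsSignChanging (signedTranslate s φ w) := by
  obtain ⟨⟨a, ha⟩, b, hb⟩ := h
  rcases hs with rfl | rfl
  · exact ⟨⟨a + φ, by simpa [signedTranslate]⟩,
      b + φ, by simpa [signedTranslate]⟩
  · exact ⟨⟨b + φ, by simpa [signedTranslate]⟩,
      a + φ, by simpa [signedTranslate]⟩

theorem isAngularMode_signedTranslate (hs : s = 1 ∨ s = -1) (h : IsAngularMode q k w) :
    IsAngularMode q k (signedTranslate s φ w) := by
  have hs₀ : s ≠ 0 := by rcases hs with rfl | rfl <;> norm_num
  refine ⟨isODESolution_signedTranslate hs h.1, isSignChanging_signedTranslate hs h.2.1, ?_⟩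
  simpa only [HasLeastPeriod, periodic_signedTranslate_iff hs₀] using h.2.2

theorem IsAngularMode.periodic_two_pi (hk : 1 ≤ k) (h : IsAngularMode q k w) :
    Function.Periodic w (2 * Real.pi) := by
  have hk₀ : (k : ℝ) ≠ 0 := by exact_mod_cast Nat.one_le_iff_ne_zero.1 hk
  simpa only [mul_div_cancel₀ _ hk₀] using h.2.2.1.2.nat_mul k

theorem IsAngularMode.exists_eq_signedTranslate (hq : 0 < q) (hq₁ : q ≠ 1) (hk : 1 ≤ k)
    (hw : IsAngularMode q k w) (hφ : w φ = 0) :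
    ∃ s : ℝ, (s = 1 ∨ s = -1) ∧ w = signedTranslate s φ (angularMode q k) := by
  obtain ⟨ρ, s, hρ, hs, rfl⟩ := exists_eq_signedTranslate_oscillation hq hw.1 hφ
    (hw.2.1.1.imp fun _ => ne_of_gt)
  have hmode : IsAngularMode q k (oscillation q ρ) := by
    simpa only [signedTranslate_neg_signedTranslate hs] using
      isAngularMode_signedTranslate (φ := -φ) hs hw
  refine ⟨s, hs, ?_⟩
  rw [angularMode, ← (isAngularMode_oscillation_iff hq hρ hk).1 hmode,
    amplitude_frequency hq hq₁ hρ]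

theorem angularMode_zero (hq : 0 < q) (k : ℕ) : angularMode q k 0 = 0 := oscillation_zero hq

theorem isAngularMode_angularMode (hq : 0 < q) (hq₁ : q ≠ 1) (hk : 1 ≤ k) :
    IsAngularMode q k (angularMode q k) := by
  have hfreq : 0 < k * genPeriod q / (2 * Real.pi) :=
    div_pos (mul_pos (by exact_mod_cast hk) (genPeriod_pos hq)) Real.two_pi_pos
  refine (isAngularMode_oscillation_iff hq ?_ hk).2 (frequency_amplitude hq hq₁ hfreq)
  exact Real.rpow_pos_of_pos (by positivity) _

theorem isAngularMode_iff (hq : 0 < q) (hq₁ : q ≠ 1) (hk : 1 ≤ k) :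
    IsAngularMode q k w ↔
      ∃ s φ : ℝ, (s = 1 ∨ s = -1) ∧ w = signedTranslate s φ (angularMode q k) := by
  refine ⟨fun h => ?_, ?_⟩
  · obtain ⟨φ, hφ⟩ := h.2.1.exists_eq_zero h.1.1.continuous
    obtain ⟨s, hs, hw⟩ := h.exists_eq_signedTranslate hq hq₁ hk hφ
    exact ⟨s, φ, hs, hw⟩
  · rintro ⟨s, φ, hs, rfl⟩
    exact isAngularMode_signedTranslate hs (isAngularMode_angularMode hq hq₁ hk)

theorem IsODESolution.exists_isAngularMode_of_periodic (hq : 0 < q) (hw : IsODESolution 0 (-1) q w)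
    (hper : Function.Periodic w (2 * Real.pi)) (hne : ∃ t, w t ≠ 0) :
    ∃ k, 1 ≤ k ∧ IsAngularMode q k w := by
  have hsign := hw.isSignChanging_of_periodic le_rfl (by norm_num) Real.two_pi_pos hper hne
  obtain ⟨φ, hφ⟩ := hsign.exists_eq_zero hw.1.continuous
  obtain ⟨ρ, s, hρ, hs, rfl⟩ := exists_eq_signedTranslate_oscillation hq hw hφ hne
  have hs₀ : s ≠ 0 := by rcases hs with rfl | rfl <;> norm_num
  obtain ⟨n, hn⟩ := (periodic_oscillation_iff hq hρ).1 ((periodic_signedTranslate_iff hs₀).1 hper)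
  have hn_pos : 0 < n := by
    exact_mod_cast pos_of_mul_pos_left (hn ▸ mul_pos (frequency_pos hq hρ) Real.two_pi_pos)
      (genPeriod_pos hq).le
  lift n to ℕ using hn_pos.le
  have hk : 1 ≤ n := by exact_mod_cast hn_pos
  refine ⟨n, hk, isAngularMode_signedTranslate hs ((isAngularMode_oscillation_iff hq hρ hk).2 ?_)⟩
  rw [eq_div_iff Real.two_pi_pos.ne', hn, Int.cast_natCast]

theorem exists_isAngularMode_iff (hq : 0 < q) :
    (∃ k, 1 ≤ k ∧ IsAngularMode q k w) ↔
      IsODESolution 0 (-1) q w ∧ Function.Periodic w (2 * Real.pi) ∧ ∃ a b, w a ≠ w b := by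
  refine ⟨?_, fun ⟨hw, hper, a, b, hab⟩ => hw.exists_isAngularMode_of_periodic hq hper ?_⟩
  · rintro ⟨k, hk, h⟩
    obtain ⟨⟨a, ha⟩, b, hb⟩ := h.2.1
    exact ⟨h.1, h.periodic_two_pi hk, a, b, (hb.trans ha).ne'⟩
  · by_contra! hzero
    exact hab ((hzero a).trans (hzero b).symm)

end AngularMode

/-! ### Polar coordinates -/

theorem deriv_deriv_comp_curve {E F : Type*} [NormedAddCommGroup E] [NormedSpace ℝ E]
    [NormedAddCommGroup F] [NormedSpace ℝ F] {u : E → F} {γ γ' : ℝ → E} {a : E} {t : ℝ}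
    (hu : ContDiffAt ℝ 2 u (γ t)) (hγ : ∀ s, HasDerivAt γ (γ' s) s) (hγ' : HasDerivAt γ' a t) :
    deriv (deriv fun s => u (γ s)) t =
      fderiv ℝ (fderiv ℝ u) (γ t) (γ' t) (γ' t) + fderiv ℝ u (γ t) a := by
  have hderiv : deriv (fun s => u (γ s)) =ᶠ[𝓝 t] fun s => fderiv ℝ u (γ s) (γ' s) := by
    filter_upwards [(hγ t).continuousAt.eventually (hu.eventually (by simp))] with s hs
    exact ((hs.differentiableAt two_ne_zero).hasFDerivAt.comp_hasDerivAt s (hγ s)).deriv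
  have hfderiv : DifferentiableAt ℝ (fderiv ℝ u) (γ t) :=
    (hu.fderiv_right (m := 1) (by norm_num)).differentiableAt one_ne_zero
  rw [hderiv.deriv_eq]
  exact ((hfderiv.hasFDerivAt.comp_hasDerivAt t (hγ t)).clm_apply hγ').deriv

theorem polar_eq_repr (r θ : ℝ) :
    polar r θ = Complex.orthonormalBasisOneI.repr (r * Complex.exp (θ * Complex.I)) := by
  ext i
  fin_cases i <;> simp [polar, Complex.exp_ofReal_mul_I_re, Complex.exp_ofReal_mul_I_im]

theorem polar_eq_smul (r θ : ℝ) : polar r θ = r • polar 1 θ := by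
  ext i
  fin_cases i <;> simp [polar]

theorem polar_add_pi (r θ : ℝ) : polar r (θ + Real.pi) = -polar r θ := by
  ext i
  fin_cases i <;> simp [polar]

theorem norm_polar {r : ℝ} (hr : 0 ≤ r) (θ : ℝ) : ‖polar r θ‖ = r := by
  rw [polar_eq_repr, LinearIsometryEquiv.norm_map, norm_mul, Complex.norm_exp_ofReal_mul_I,
    mul_one, Complex.norm_of_nonneg hr]

theorem hasDerivAt_polar_exp (θ t : ℝ) :
    HasDerivAt (fun t => polar (Real.exp t) θ) (polar (Real.exp t) θ) t := by
  rw [funext fun t => polar_eq_smul (Real.exp t) θ, polar_eq_smul (Real.exp t) θ]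
  exact (Real.hasDerivAt_exp t).smul_const (polar 1 θ)

theorem hasDerivAt_polar_angle (r θ : ℝ) :
    HasDerivAt (polar r) (polar r (θ + Real.pi / 2)) θ := by
  have hexp : HasDerivAt (fun θ : ℝ => (r : ℂ) * Complex.exp (θ * Complex.I))
      (r * Complex.exp ((θ + Real.pi / 2 : ℝ) * Complex.I)) θ := by
    refine (((Complex.ofRealCLM.hasDerivAt.mul_const Complex.I).cexp).const_mul (r : ℂ)).congr_deriv
      ?_
    simp [add_mul, Complex.exp_add]
  rw [polar_eq_repr, funext (polar_eq_repr r)]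
  exact Complex.orthonormalBasisOneI.repr.toContinuousLinearEquiv.hasFDerivAt.comp_hasDerivAt θ hexp

theorem contDiff_polar (r : ℝ) {n : ℕ∞} : ContDiff ℝ n (polar r) := by
  rw [funext (polar_eq_repr r)]
  exact Complex.orthonormalBasisOneI.repr.contDiff.comp (contDiff_const.mul
    (Complex.contDiff_exp.comp (Complex.ofRealCLM.contDiff.mul contDiff_const)))

/-- The orthonormal frame of the radial and the angular direction at angle `θ`. -/
def polarFrame (θ : ℝ) : OrthonormalBasis (Fin 2) ℝ Plane :=
  Complex.orthonormalBasisOneI.map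
    ((rotation (Circle.exp θ)).trans Complex.orthonormalBasisOneI.repr)

theorem polarFrame_zero (θ : ℝ) : polarFrame θ 0 = polar 1 θ := by
  simp [polarFrame, polar_eq_repr, Circle.coe_exp]

theorem polarFrame_one (θ : ℝ) : polarFrame θ 1 = polar 1 (θ + Real.pi / 2) := by
  simp [polarFrame, polar_eq_repr, Circle.coe_exp, add_mul, Complex.exp_add]

theorem deriv_deriv_polar_add {u : Plane → ℝ} {t θ : ℝ}
    (hu : ContDiffAt ℝ 2 u (polar (Real.exp t) θ)) :
    deriv (deriv fun t => u (polar (Real.exp t) θ)) t +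
      deriv (deriv fun θ => u (polar (Real.exp t) θ)) θ =
      Real.exp t ^ 2 * Laplacian.laplacian u (polar (Real.exp t) θ) := by
  have hradial := deriv_deriv_comp_curve (γ := fun t => polar (Real.exp t) θ) hu
    (hasDerivAt_polar_exp θ) (hasDerivAt_polar_exp θ t)
  have hangular := deriv_deriv_comp_curve hu (hasDerivAt_polar_angle _)
    ((hasDerivAt_polar_angle _ (θ + Real.pi / 2)).comp_add_const θ (Real.pi / 2))
  rw [add_assoc, add_halves, polar_add_pi, map_neg] at hangular
  rw [hradial, hangular,
    InnerProductSpace.laplacian_eq_iteratedFDeriv_orthonormalBasis u (polarFrame θ)]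
  simp only [Fin.sum_univ_two, iteratedFDeriv_two_apply, Matrix.cons_val_zero, Matrix.cons_val_one,
    polarFrame_zero, polarFrame_one]
  rw [polar_eq_smul _ θ, polar_eq_smul _ (θ + Real.pi / 2)]
  simp only [map_smul, smul_apply, smul_eq_mul]
  ring

/-- The polar angle of `x` in `(θ₀ - π, θ₀ + π]`, a branch which is smooth near angle `θ₀`. -/
def angleNear (θ₀ : ℝ) (x : Plane) : ℝ :=
  θ₀ + Complex.arg (Complex.orthonormalBasisOneI.repr.symm x * Complex.exp (-(θ₀ * Complex.I)))

theorem polar_norm_angleNear (θ₀ : ℝ) (x : Plane) : polar ‖x‖ (angleNear θ₀ x) = x := by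
  rw [polar_eq_repr, ← LinearIsometryEquiv.eq_symm_apply, angleNear]
  set z := Complex.orthonormalBasisOneI.repr.symm x
  have hz : ‖z * Complex.exp (-(θ₀ * Complex.I))‖ = ‖x‖ := by
    rw [norm_mul, Complex.exp_neg, norm_inv, Complex.norm_exp_ofReal_mul_I, inv_one, mul_one,
      LinearIsometryEquiv.norm_map]
  have harg := Complex.norm_mul_exp_arg_mul_I (z * Complex.exp (-(θ₀ * Complex.I)))
  rw [hz] at harg
  rw [Complex.ofReal_add, add_mul, Complex.exp_add, mul_left_comm, harg, mul_left_comm,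
    ← Complex.exp_add, add_neg_cancel, Complex.exp_zero, mul_one]

theorem exists_polar_norm_eq (x : Plane) : ∃ θ, polar ‖x‖ θ = x := ⟨_, polar_norm_angleNear 0 x⟩

theorem contDiffAt_angleNear {r : ℝ} (hr : 0 < r) (θ : ℝ) :
    ContDiffAt ℝ 2 (angleNear θ) (polar r θ) := by
  set L : Plane → ℂ := fun x =>
    Complex.orthonormalBasisOneI.repr.symm x * Complex.exp (-(θ * Complex.I))
  have hL_smooth : ContDiff ℝ 2 L :=
    Complex.orthonormalBasisOneI.repr.symm.contDiff.mul contDiff_const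
  have hL_polar : L (polar r θ) = r := by
    simp only [L]
    rw [polar_eq_repr, LinearIsometryEquiv.symm_apply_apply, mul_assoc, ← Complex.exp_add,
      add_neg_cancel, Complex.exp_zero, mul_one]
  have hlog : ContDiffAt ℝ 2 Complex.log (L (polar r θ)) := by
    rw [hL_polar]
    exact (Complex.contDiffAt_log (Complex.ofReal_mem_slitPlane.2 hr)).restrict_scalars ℝ
  have him := Complex.imCLM.contDiff.contDiffAt.comp (polar r θ)
    (hlog.comp (polar r θ) hL_smooth.contDiffAt)
  refine ContDiffAt.congr_of_eventuallyEq (f := fun x => θ + (Complex.log (L x)).im)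
    (contDiffAt_const.add him) (Eventually.of_forall fun x => ?_)
  simp only [angleNear, Complex.log_im, L]

/-! ### Separation of variables -/

/-- The range of `ln |x|` for `x` in the annulus. -/
def logInterval (R₁ : ℝ) (R₂ : EReal) : Set ℝ :=
  {t | R₁ < Real.exp t ∧ ((Real.exp t : ℝ) : EReal) < R₂}

/-- On the annulus, `u(r, θ) = f(ln r) w(θ)`. The radial factor is a function of `t = ln r`
because `|x|² Δ` becomes `∂ₜ² + ∂_θ²` in the coordinates `(t, θ)`. -/
def IsSeparated (R₁ : ℝ) (R₂ : EReal) (f w : ℝ → ℝ) (u : Plane → ℝ) : Prop :=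
  ∀ t ∈ logInterval R₁ R₂, ∀ θ, u (polar (Real.exp t) θ) = f t * w θ

section Annulus

variable {R₁ : ℝ} {R₂ : EReal}

theorem isOpen_annulus : IsOpen (annulus R₁ R₂) :=
  (isOpen_lt continuous_const continuous_norm).inter
    (isOpen_lt (continuous_coe_real_ereal.comp continuous_norm) continuous_const)

theorem isOpen_logInterval : IsOpen (logInterval R₁ R₂) :=
  (isOpen_lt continuous_const Real.continuous_exp).inter
    (isOpen_lt (continuous_coe_real_ereal.comp Real.continuous_exp) continuous_const)

theorem isPreconnected_logInterval : IsPreconnected (logInterval R₁ R₂) := by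
  refine OrdConnected.isPreconnected ⟨fun x hx y hy z hz => ⟨?_, ?_⟩⟩
  · exact hx.1.trans_le (Real.exp_le_exp.2 hz.1)
  · exact (EReal.coe_le_coe_iff.2 (Real.exp_le_exp.2 hz.2)).trans_lt hy.2

theorem polar_exp_mem_annulus {t : ℝ} (ht : t ∈ logInterval R₁ R₂) (θ : ℝ) :
    polar (Real.exp t) θ ∈ annulus R₁ R₂ := by
  rw [annulus, mem_ofPred_eq, norm_polar (Real.exp_pos t).le]
  exact ht

theorem forall_mem_logInterval_iff (h₀ : 0 ≤ R₁) {p : ℝ → Prop} :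
    (∀ t ∈ logInterval R₁ R₂, p (Real.exp t)) ↔ ∀ r : ℝ, R₁ < r → (r : EReal) < R₂ → p r := by
  refine ⟨fun h r h₁ h₂ => ?_, fun h t ht => h _ ht.1 ht.2⟩
  have hr := Real.exp_log (h₀.trans_lt h₁)
  rw [← hr]
  exact h _ ⟨hr.symm ▸ h₁, hr.symm ▸ h₂⟩

theorem forall_mem_logInterval_pos {M N : ℝ}
    (hpos : ∀ r : ℝ, R₁ < r → (r : EReal) < R₂ → 0 < M + N * Real.log r) :
    ∀ t ∈ logInterval R₁ R₂, 0 < M + N * t := fun t ht => by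
  simpa only [Real.log_exp] using hpos (Real.exp t) ht.1 ht.2

theorem nonempty_logInterval (h₀ : 0 ≤ R₁) (h : (R₁ : EReal) < R₂) :
    (logInterval R₁ R₂).Nonempty := by
  by_contra! hempty
  obtain ⟨r, h₁, h₂⟩ := EReal.lt_iff_exists_real_btwn.1 h
  refine (forall_mem_logInterval_iff (p := fun _ => False) h₀).1 (fun t ht => ?_) r
    (EReal.coe_lt_coe_iff.1 h₁) h₂
  simp [hempty] at ht

theorem forall_mem_annulus_iff (h₀ : 0 ≤ R₁) {p : Plane → Prop} :
    (∀ x ∈ annulus R₁ R₂, p x) ↔ ∀ t ∈ logInterval R₁ R₂, ∀ θ, p (polar (Real.exp t) θ) := by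
  refine ⟨fun h t ht θ => h _ (polar_exp_mem_annulus ht θ), fun h x hx => ?_⟩
  obtain ⟨θ, hθ⟩ := exists_polar_norm_eq x
  rw [← hθ]
  exact (forall_mem_logInterval_iff h₀ (p := fun r => ∀ θ, p (polar r θ))).1 h _ hx.1 hx.2 θ

theorem isRadial_iff (h₀ : 0 ≤ R₁) {u : Plane → ℝ} :
    IsRadial R₁ R₂ u ↔ ∀ t ∈ logInterval R₁ R₂, ∀ θ φ,
      u (polar (Real.exp t) θ) = u (polar (Real.exp t) φ) := by
  refine ⟨fun h t ht θ φ => h _ (polar_exp_mem_annulus ht θ) _ (polar_exp_mem_annulus ht φ) ?_,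
    fun h => (forall_mem_annulus_iff h₀).2 fun t ht θ y _ hy => ?_⟩
  · simp only [norm_polar (Real.exp_pos t).le]
  · obtain ⟨φ, hφ⟩ := exists_polar_norm_eq y
    rw [← hφ, ← hy, norm_polar (Real.exp_pos t).le]
    exact h t ht θ φ

theorem isPseudoRadial_iff (h₀ : 0 ≤ R₁) {u : Plane → ℝ} :
    IsPseudoRadial R₁ R₂ u ↔
      ∃ f w : ℝ → ℝ, Function.Periodic w (2 * Real.pi) ∧ IsSeparated R₁ R₂ f w u := by
  refine ⟨fun ⟨h, w, hper, hu⟩ => ⟨fun t => h (Real.exp t), w, hper, fun t ht θ =>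
    hu _ θ ht.1 ht.2⟩, fun ⟨f, w, hper, hu⟩ => ⟨fun r => f (Real.log r), w, hper, ?_⟩⟩
  refine fun r θ => (forall_mem_logInterval_iff h₀
    (p := fun r => u (polar r θ) = f (Real.log r) * w θ)).1 (fun t ht => ?_) r
  rw [hu t ht, Real.log_exp]

theorem isRotatedProfile_iff (h₀ : 0 ≤ R₁) {M N : ℝ} {w : ℝ → ℝ} {u : Plane → ℝ} :
    IsRotatedProfile R₁ R₂ M N w u ↔ ∃ s φ : ℝ, (s = 1 ∨ s = -1) ∧
      IsSeparated R₁ R₂ (fun t => M + N * t) (signedTranslate s φ w) u := by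
  refine exists_congr fun s => exists_congr fun φ => and_congr_right fun _ => ?_
  have hlog := forall_mem_logInterval_iff h₀ (R₂ := R₂)
    (p := fun r => ∀ θ, u (polar r θ) = s * ((M + N * Real.log r) * w (θ - φ)))
  simp only [Real.log_exp, mul_left_comm s] at hlog
  simp only [IsSeparated, signedTranslate, mul_left_comm s, hlog]
  exact ⟨fun h r h₁ h₂ θ => h r θ h₁ h₂, fun h r θ h₁ h₂ => h r h₁ h₂ θ⟩

end Annulus

theorem eq_of_forall_abs_eq {X : Type*} [TopologicalSpace X] {I : Set X} (hI : IsPreconnected I)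
    {g : X → ℝ} (hg : ContinuousOn g I)
    (habs : ∀ x ∈ I, ∀ y ∈ I, g x ≠ 0 → g y ≠ 0 → |g x| = |g y|) {x y : X} (hx : x ∈ I)
    (hy : y ∈ I) : g x = g y := by
  by_cases hzero : ∀ z ∈ I, g z = 0
  · rw [hzero x hx, hzero y hy]
  push Not at hzero
  obtain ⟨z, hz, hgz⟩ := hzero
  have hfinite : ({0, g z, -g z} : Set ℝ).Finite := by simp
  refine hI.constant_of_mapsTo hfinite.isDiscrete hg (fun a ha => ?_) hx hy
  rcases eq_or_ne (g a) 0 with hga | hga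
  · exact Or.inl hga
  · exact Or.inr (abs_eq_abs.1 (habs a ha z hz hga hgz))

theorem exists_abs_ne_of_ne {X : Type*} [TopologicalSpace X] [PreconnectedSpace X] {g : X → ℝ}
    (hg : Continuous g) {a b : X} (hab : g a ≠ g b) :
    ∃ x y, g x ≠ 0 ∧ g y ≠ 0 ∧ |g x| ≠ |g y| := by
  by_contra! habs
  exact hab (eq_of_forall_abs_eq isPreconnected_univ hg.continuousOn
    (fun x _ y _ => habs x y) (mem_univ a) (mem_univ b))

-- The values at two angles eliminate `c`, the second derivative of the radial factor `p * z`.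
theorem abs_rpow_eq_of_separated {q ε p z c w₁ w₂ a₁ a₂ : ℝ} (hp : 0 < p) (hz : z ≠ 0)
    (hd : ε * (signedPow q w₁ * w₂ - signedPow q w₂ * w₁) ≠ 0)
    (h₁ : c * w₁ + p * z * a₁ = ε * (p ^ (1 - q) * signedPow q (p * z * w₁)))
    (h₂ : c * w₂ + p * z * a₂ = ε * (p ^ (1 - q) * signedPow q (p * z * w₂))) :
    |z| ^ (q - 1) =
      (a₁ * w₂ - a₂ * w₁) / (ε * (signedPow q w₁ * w₂ - signedPow q w₂ * w₁)) := by
  have hz_pow : signedPow q z = z * |z| ^ (q - 1) := rfl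
  rw [mul_assoc p z w₁, rpow_one_sub_mul_signedPow hp, signedPow_mul, hz_pow] at h₁
  rw [mul_assoc p z w₂, rpow_one_sub_mul_signedPow hp, signedPow_mul, hz_pow] at h₂
  rw [eq_div_iff hd]
  refine mul_left_cancel₀ (mul_ne_zero hp.ne' hz) ?_
  linear_combination w₁ * h₂ - w₂ * h₁

theorem exists_eq_mul_of_separated {q ε : ℝ} (hq₁ : q ≠ 1) (hε : ε ≠ 0) {I : Set ℝ}
    (hI : IsPreconnected I) {p f f₂ w w₂ : ℝ → ℝ} (hp_pos : ∀ t ∈ I, 0 < p t)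
    (hp : ContinuousOn p I) (hf : ContinuousOn f I) (hw : Continuous w) {a b : ℝ} (hab : w a ≠ w b)
    (heq : ∀ t ∈ I, ∀ θ, f₂ t * w θ + f t * w₂ θ =
      ε * (p t ^ (1 - q) * signedPow q (f t * w θ))) :
    ∃ c, ∀ t ∈ I, f t = p t * c := by
  obtain ⟨x, y, hx, hy, hxy⟩ := exists_abs_ne_of_ne hw hab
  have hd := mul_ne_zero hε (signedPow_mul_sub_signedPow_mul_ne_zero hq₁ hx hy hxy)
  have hfp (t : ℝ) (ht : t ∈ I) : f t = p t * (f t / p t) :=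
    (mul_div_cancel₀ _ (hp_pos t ht).ne').symm
  have heq' (t : ℝ) (ht : t ∈ I) (θ : ℝ) : f₂ t * w θ + p t * (f t / p t) * w₂ θ =
      ε * (p t ^ (1 - q) * signedPow q (p t * (f t / p t) * w θ)) := by
    rw [← hfp t ht]
    exact heq t ht θ
  have habs : ∀ s ∈ I, ∀ t ∈ I, f s / p s ≠ 0 → f t / p t ≠ 0 → |f s / p s| = |f t / p t| := by
    intro s hs t ht hs₀ ht₀
    have hs_pow := abs_rpow_eq_of_separated (hp_pos s hs) hs₀ hd (heq' s hs x) (heq' s hs y)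
    have ht_pow := abs_rpow_eq_of_separated (hp_pos t ht) ht₀ hd (heq' t ht x) (heq' t ht y)
    exact (Real.rpow_left_inj (abs_nonneg _) (abs_nonneg _) (sub_ne_zero.2 hq₁)).1
      (hs_pow.trans ht_pow.symm)
  rcases I.eq_empty_or_nonempty with rfl | ⟨t₀, ht₀⟩
  · simp
  refine ⟨f t₀ / p t₀, fun t ht => ?_⟩
  have hconst : f t₀ / p t₀ = f t / p t :=
    eq_of_forall_abs_eq hI (hf.div hp fun t ht => (hp_pos t ht).ne') habs ht₀ ht
  rw [hconst, ← hfp t ht]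

section Separated

variable {R₁ M N ε q : ℝ} {R₂ : EReal} {f w : ℝ → ℝ} {u : Plane → ℝ}

theorem IsSeparated.contDiffOn (h₀ : 0 ≤ R₁) (h : IsSeparated R₁ R₂ f w u)
    (hf : ContDiffOn ℝ 2 f (logInterval R₁ R₂)) (hw : ContDiff ℝ 2 w) :
    ContDiffOn ℝ 2 u (annulus R₁ R₂) := by
  refine fun x hx => ContDiffAt.contDiffWithinAt ?_
  have hmem {y : Plane} (hy : y ∈ annulus R₁ R₂) : Real.log ‖y‖ ∈ logInterval R₁ R₂ := by
    rw [logInterval, mem_ofPred_eq, Real.exp_log (h₀.trans_lt hy.1)]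
    exact hy
  have hnorm : 0 < ‖x‖ := h₀.trans_lt hx.1
  obtain ⟨θ, hθ⟩ := exists_polar_norm_eq x
  have hangle : ContDiffAt ℝ 2 (angleNear θ) x := hθ ▸ contDiffAt_angleNear hnorm θ
  have hlog : ContDiffAt ℝ 2 (fun y : Plane => Real.log ‖y‖) x :=
    (contDiffAt_norm ℝ (norm_pos_iff.1 hnorm)).log hnorm.ne'
  refine (((hf.contDiffAt (isOpen_logInterval.mem_nhds (hmem hx))).comp x hlog).mul
    (hw.contDiffAt.comp x hangle)).congr_of_eventuallyEq ?_
  filter_upwards [isOpen_annulus.mem_nhds hx] with y hy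
  have hy_eq := h _ (hmem hy) (angleNear θ y)
  rwa [Real.exp_log (h₀.trans_lt hy.1), polar_norm_angleNear] at hy_eq

theorem IsSeparated.contDiff_angular (h : IsSeparated R₁ R₂ f w u)
    (hu : ContDiffOn ℝ 2 u (annulus R₁ R₂)) {t : ℝ} (ht : t ∈ logInterval R₁ R₂) (hft : f t ≠ 0) :
    ContDiff ℝ 2 w := by
  have hw : w = fun θ => (f t)⁻¹ * u (polar (Real.exp t) θ) := funext fun θ => by
    rw [h t ht, inv_mul_cancel_left₀ hft]
  rw [hw]
  exact contDiff_const.mul (hu.comp_contDiff (contDiff_polar _) (polar_exp_mem_annulus ht))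

theorem IsSeparated.continuousOn_radial (h : IsSeparated R₁ R₂ f w u)
    (hu : ContinuousOn u (annulus R₁ R₂)) {θ : ℝ} (hθ : w θ ≠ 0) :
    ContinuousOn f (logInterval R₁ R₂) := by
  have hpolar : Continuous fun t => polar (Real.exp t) θ :=
    continuous_iff_continuousAt.2 fun t => (hasDerivAt_polar_exp θ t).continuousAt
  refine ((hu.comp hpolar.continuousOn fun t ht => polar_exp_mem_annulus ht θ).div_const
    (w θ)).congr fun t ht => ?_
  simp only [Function.comp_apply]
  rw [h t ht, mul_div_cancel_right₀ _ hθ]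

theorem IsSeparated.exp_sq_mul_laplacian (h : IsSeparated R₁ R₂ f w u)
    (hu : ContDiffOn ℝ 2 u (annulus R₁ R₂)) {t : ℝ} (ht : t ∈ logInterval R₁ R₂) (θ : ℝ) :
    Real.exp t ^ 2 * Laplacian.laplacian u (polar (Real.exp t) θ) =
      deriv (deriv f) t * w θ + f t * deriv (deriv w) θ := by
  have hradial : (fun t => u (polar (Real.exp t) θ)) =ᶠ[𝓝 t] fun t => f t * w θ := by
    filter_upwards [isOpen_logInterval.mem_nhds ht] with s hs using h s hs θ
  have hangular : (fun θ => u (polar (Real.exp t) θ)) = fun θ => f t * w θ := funext (h t ht)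
  rw [← deriv_deriv_polar_add (hu.contDiffAt (isOpen_annulus.mem_nhds
    (polar_exp_mem_annulus ht θ))), hradial.deriv.deriv_eq, hangular]
  simp only [deriv_mul_const_field', deriv_const_mul_field', deriv_mul_const_field,
    deriv_const_mul_field]

theorem IsSeparated.isSolution_iff (h₀ : 0 ≤ R₁) (h : IsSeparated R₁ R₂ f w u) :
    IsSolution R₁ R₂ M N ε q u ↔ ContDiffOn ℝ 2 u (annulus R₁ R₂) ∧
      ∀ t ∈ logInterval R₁ R₂, ∀ θ, deriv (deriv f) t * w θ + f t * deriv (deriv w) θ =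
        ε * ((M + N * t) ^ (1 - q) * signedPow q (f t * w θ)) := by
  refine and_congr_right fun hu => ?_
  rw [forall_mem_annulus_iff h₀]
  refine forall₃_congr fun t ht θ => ?_
  rw [← h.exp_sq_mul_laplacian hu ht, norm_polar (Real.exp_pos t).le, Real.log_exp, h t ht θ,
    signedPow, ← mul_right_inj' (pow_pos (Real.exp_pos t) 2).ne']
  field_simp

theorem IsSeparated.not_isRadial_iff (h₀ : 0 ≤ R₁) (h : IsSeparated R₁ R₂ f w u) :
    ¬IsRadial R₁ R₂ u ↔ (∃ t ∈ logInterval R₁ R₂, f t ≠ 0) ∧ ∃ a b, w a ≠ w b := by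
  have hrad : IsRadial R₁ R₂ u ↔ ∀ t ∈ logInterval R₁ R₂, ∀ a b, w a = w b ∨ f t = 0 := by
    rw [isRadial_iff h₀]
    refine forall₄_congr fun t ht a b => ?_
    rw [h t ht, h t ht, mul_eq_mul_left_iff]
  rw [hrad]
  push Not
  exact ⟨fun ⟨t, ht, a, b, hab, hft⟩ => ⟨⟨t, ht, hft⟩, a, b, hab⟩,
    fun ⟨⟨t, ht, hft⟩, a, b, hab⟩ => ⟨t, ht, a, b, hab, hft⟩⟩

theorem IsSeparated.isSolution_iff_isODESolution (h₀ : 0 ≤ R₁)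
    (hne : (logInterval R₁ R₂).Nonempty) (hpos : ∀ t ∈ logInterval R₁ R₂, 0 < M + N * t)
    (h : IsSeparated R₁ R₂ (fun t => M + N * t) w u) :
    IsSolution R₁ R₂ M N ε q u ↔ IsODESolution 0 ε q w := by
  obtain ⟨t₀, ht₀⟩ := hne
  have hsmooth : ContDiffOn ℝ 2 u (annulus R₁ R₂) ↔ ContDiff ℝ 2 w :=
    ⟨fun hu => h.contDiff_angular hu ht₀ (hpos t₀ ht₀).ne', h.contDiffOn h₀ (by fun_prop)⟩
  have hequation (t : ℝ) (ht : t ∈ logInterval R₁ R₂) (θ : ℝ) :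
      deriv (deriv fun t => M + N * t) t * w θ + (M + N * t) * deriv (deriv w) θ =
        ε * ((M + N * t) ^ (1 - q) * signedPow q ((M + N * t) * w θ)) ↔
      deriv (deriv w) θ + 0 * w θ = ε * signedPow q (w θ) := by
    have haffine : deriv (fun t => M + N * t) = fun _ => N := funext fun t => by simp
    rw [haffine, deriv_const, rpow_one_sub_mul_signedPow (hpos t ht), zero_mul, zero_add,
      add_zero, mul_left_comm ε, mul_right_inj' (hpos t ht).ne']
  rw [h.isSolution_iff h₀, hsmooth, IsODESolution]
  refine and_congr_right fun _ => ⟨fun heq θ => (hequation t₀ ht₀ θ).1 (heq t₀ ht₀ θ),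
    fun heq t ht θ => (hequation t ht θ).2 (heq θ)⟩

theorem IsSeparated.angular_unique {v : ℝ → ℝ} (hv : IsSeparated R₁ R₂ f v u)
    (hw : IsSeparated R₁ R₂ f w u) {t : ℝ} (ht : t ∈ logInterval R₁ R₂) (hft : f t ≠ 0) : v = w :=
  funext fun θ => mul_left_cancel₀ hft ((hv t ht θ).symm.trans (hw t ht θ))

theorem nonradial_solution_iff_isSeparated (h₀ : 0 ≤ R₁) (hq₁ : q ≠ 1) (hε : ε ≠ 0)
    (hne : (logInterval R₁ R₂).Nonempty) (hpos : ∀ t ∈ logInterval R₁ R₂, 0 < M + N * t) :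
    (IsSolution R₁ R₂ M N ε q u ∧ IsPseudoRadial R₁ R₂ u ∧ ¬IsRadial R₁ R₂ u) ↔
      ∃ w, (IsODESolution 0 ε q w ∧ Function.Periodic w (2 * Real.pi) ∧ ∃ a b, w a ≠ w b) ∧
        IsSeparated R₁ R₂ (fun t => M + N * t) w u := by
  constructor
  · rintro ⟨hsol, hpseudo, hnonradial⟩
    obtain ⟨f, w, hper, h⟩ := (isPseudoRadial_iff h₀).1 hpseudo
    obtain ⟨⟨t, ht, hft⟩, a, b, hab⟩ := (h.not_isRadial_iff h₀).1 hnonradial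
    obtain ⟨hu, heq⟩ := (h.isSolution_iff h₀).1 hsol
    have hw := (h.contDiff_angular hu ht hft).continuous
    obtain ⟨θ, -, hθ, -⟩ := exists_abs_ne_of_ne hw hab
    obtain ⟨c, hc⟩ := exists_eq_mul_of_separated hq₁ hε isPreconnected_logInterval hpos
      (by fun_prop) (h.continuousOn_radial hu.continuousOn hθ) hw hab heq
    have hc₀ : c ≠ 0 := right_ne_zero_of_mul (hc t ht ▸ hft)
    have hcw : IsSeparated R₁ R₂ (fun t => M + N * t) (fun θ => c * w θ) u := fun t ht θ => by
      rw [h t ht, hc t ht, mul_assoc]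
    exact ⟨_, ⟨(hcw.isSolution_iff_isODESolution h₀ hne hpos).1 hsol,
      fun θ => congrArg (c * ·) (hper θ), a, b, (mul_right_injective₀ hc₀).ne hab⟩, hcw⟩
  · rintro ⟨w, ⟨hsol, hper, hab⟩, h⟩
    obtain ⟨t, ht⟩ := hne
    exact ⟨(h.isSolution_iff_isODESolution h₀ ⟨t, ht⟩ hpos).2 hsol,
      (isPseudoRadial_iff h₀).2 ⟨_, w, hper, h⟩,
      (h.not_isRadial_iff h₀).2 ⟨⟨t, ht, (hpos t ht).ne'⟩, hab⟩⟩

end Separated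

section Classification

variable {R₁ M N ε q : ℝ} {R₂ : EReal} {u : Plane → ℝ}

theorem IsPseudoRadial.isRadial (hpseudo : IsPseudoRadial R₁ R₂ u) (hq₁ : q ≠ 1) (h₀ : 0 ≤ R₁)
    (hε : 0 < ε) (hne : (logInterval R₁ R₂).Nonempty)
    (hpos : ∀ t ∈ logInterval R₁ R₂, 0 < M + N * t) (hu : IsSolution R₁ R₂ M N ε q u) :
    IsRadial R₁ R₂ u := by
  by_contra hnonradial
  obtain ⟨w, ⟨hw, hper, a, b, hab⟩, -⟩ :=
    (nonradial_solution_iff_isSeparated h₀ hq₁ hε.ne' hne hpos).1 ⟨hu, hpseudo, hnonradial⟩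
  exact hab (hw.eq_of_periodic le_rfl hε.le Real.two_pi_pos hper a b)

theorem isRotatedProfile_angularMode_iff (hq : 0 < q) (hq₁ : q ≠ 1) (h₀ : 0 ≤ R₁) {k : ℕ}
    (hk : 1 ≤ k) :
    IsRotatedProfile R₁ R₂ M N (angularMode q k) u ↔
      ∃ w, IsAngularMode q k w ∧ IsSeparated R₁ R₂ (fun t => M + N * t) w u := by
  rw [isRotatedProfile_iff h₀]
  constructor
  · rintro ⟨s, φ, hs, h⟩
    exact ⟨_, (isAngularMode_iff hq hq₁ hk).2 ⟨s, φ, hs, rfl⟩, h⟩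
  · rintro ⟨w, hw, h⟩
    obtain ⟨s, φ, hs, rfl⟩ := (isAngularMode_iff hq hq₁ hk).1 hw
    exact ⟨s, φ, hs, h⟩

theorem nonradial_solution_iff_isRotatedProfile (hq : 0 < q) (hq₁ : q ≠ 1) (h₀ : 0 ≤ R₁)
    (hne : (logInterval R₁ R₂).Nonempty) (hpos : ∀ t ∈ logInterval R₁ R₂, 0 < M + N * t) :
    (IsSolution R₁ R₂ M N (-1) q u ∧ IsPseudoRadial R₁ R₂ u ∧ ¬IsRadial R₁ R₂ u) ↔
      ∃ k, 1 ≤ k ∧ IsRotatedProfile R₁ R₂ M N (angularMode q k) u := by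
  simp only [nonradial_solution_iff_isSeparated h₀ hq₁ (neg_ne_zero.2 one_ne_zero) hne hpos,
    ← exists_isAngularMode_iff hq]
  constructor
  · rintro ⟨w, ⟨k, hk, hw⟩, h⟩
    exact ⟨k, hk, (isRotatedProfile_angularMode_iff hq hq₁ h₀ hk).2 ⟨w, hw, h⟩⟩
  · rintro ⟨k, hk, hprofile⟩
    obtain ⟨w, hw, h⟩ := (isRotatedProfile_angularMode_iff hq hq₁ h₀ hk).1 hprofile
    exact ⟨w, ⟨k, hk, hw⟩, h⟩

theorem IsRotatedProfile.index_unique (hq : 0 < q) (hq₁ : q ≠ 1) (h₀ : 0 ≤ R₁)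
    (hne : (logInterval R₁ R₂).Nonempty) (hpos : ∀ t ∈ logInterval R₁ R₂, 0 < M + N * t)
    {j k : ℕ} (hj : 1 ≤ j) (hk : 1 ≤ k) (huj : IsRotatedProfile R₁ R₂ M N (angularMode q j) u)
    (huk : IsRotatedProfile R₁ R₂ M N (angularMode q k) u) : j = k := by
  obtain ⟨t, ht⟩ := hne
  obtain ⟨v, hv, hvu⟩ := (isRotatedProfile_angularMode_iff hq hq₁ h₀ hj).1 huj
  obtain ⟨w, hw, hwu⟩ := (isRotatedProfile_angularMode_iff hq hq₁ h₀ hk).1 huk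
  obtain rfl := hvu.angular_unique hwu ht (hpos t ht).ne'
  exact hv.index_unique hj hk hw

end Classification

end PseudoRadial

end

theorem theorem4p3 (q : ℝ) (hq₀ : 0 < q) (hq₁ : q ≠ 1) :
    -- `ε = +1`
    (∀ (R₁ : ℝ) (R₂ : EReal) (M N : ℝ), 0 ≤ R₁ → (R₁ : EReal) < R₂ →
      (∀ r : ℝ, R₁ < r → (r : EReal) < R₂ → 0 < M + N * Real.log r) →
      ∀ u : PseudoRadial.Plane → ℝ,
        PseudoRadial.IsSolution R₁ R₂ M N 1 q u → PseudoRadial.IsPseudoRadial R₁ R₂ u →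
          PseudoRadial.IsRadial R₁ R₂ u) ∧
    -- `ε = -1`
    ∃ w : ℕ → ℝ → ℝ,
      -- for each `k ≥ 1`, `w k` is the unique mode `k`, up to sign (and translation)
      (∀ k : ℕ, 1 ≤ k →
        PseudoRadial.IsAngularMode q k (w k) ∧ w k 0 = 0 ∧
        (∀ v : ℝ → ℝ, PseudoRadial.IsAngularMode q k v → v 0 = 0 →
          v = w k ∨ v = -(w k)) ∧
        (∀ v : ℝ → ℝ, PseudoRadial.IsAngularMode q k v →
          ∃ s φ : ℝ, (s = 1 ∨ s = -1) ∧ ∀ θ, v θ = s * w k (θ - φ))) ∧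
      (∀ (R₁ : ℝ) (R₂ : EReal) (M N : ℝ), 0 ≤ R₁ → (R₁ : EReal) < R₂ →
        (∀ r : ℝ, R₁ < r → (r : EReal) < R₂ → 0 < M + N * Real.log r) →
        ∀ u : PseudoRadial.Plane → ℝ,
          -- the non-radial pseudo-radial solutions are exactly the listed functions
          ((PseudoRadial.IsSolution R₁ R₂ M N (-1) q u ∧
              PseudoRadial.IsPseudoRadial R₁ R₂ u ∧ ¬ PseudoRadial.IsRadial R₁ R₂ u) ↔
            ∃ k : ℕ, 1 ≤ k ∧ PseudoRadial.IsRotatedProfile R₁ R₂ M N (w k) u) ∧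
          -- and the integer `k` is determined by the solution
          (∀ j k : ℕ, 1 ≤ j → 1 ≤ k →
            PseudoRadial.IsRotatedProfile R₁ R₂ M N (w j) u →
            PseudoRadial.IsRotatedProfile R₁ R₂ M N (w k) u → j = k)) := by
  refine ⟨fun R₁ R₂ M N h₀ h hlog u hu hpseudo => ?_, PseudoRadial.angularMode q,
    fun k hk => ⟨PseudoRadial.isAngularMode_angularMode hq₀ hq₁ hk,
      PseudoRadial.angularMode_zero hq₀ k, fun v hv hv₀ => ?_, fun v hv => ?_⟩,
    fun R₁ R₂ M N h₀ h hlog u => ?_⟩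
  · exact hpseudo.isRadial hq₁ h₀ one_pos (PseudoRadial.nonempty_logInterval h₀ h)
      (PseudoRadial.forall_mem_logInterval_pos hlog) hu
  · obtain ⟨s, rfl | rfl, rfl⟩ := hv.exists_eq_signedTranslate hq₀ hq₁ hk hv₀
    · exact Or.inl (funext fun θ => by simp [PseudoRadial.signedTranslate])
    · exact Or.inr (funext fun θ => by simp [PseudoRadial.signedTranslate])
  · obtain ⟨s, φ, hs, rfl⟩ := (PseudoRadial.isAngularMode_iff hq₀ hq₁ hk).1 hv
    exact ⟨s, φ, hs, fun θ => rfl⟩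
  · have hne := PseudoRadial.nonempty_logInterval h₀ h
    have hpos := PseudoRadial.forall_mem_logInterval_pos hlog
    exact ⟨PseudoRadial.nonradial_solution_iff_isRotatedProfile hq₀ hq₁ h₀ hne hpos,
      fun j k => PseudoRadial.IsRotatedProfile.index_unique hq₀ hq₁ h₀ hne hpos⟩
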